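/- Let $k$ be a field, $n\ge 4$, and $R=k[x_1,\dots,x_n,y_1,\dots,y_n]$ with irrelevant ideal $\mathfrak m=(x_1,\dots,x_n,y_1,\dots,y_n)$; put $\delta_{i,j}=x_iy_j-x_jy_i$. For a graph $\Gamma$ with vertices in $\{1,\dots,n\}$ let $\mathcal J(\Gamma)=(\delta_{i,j}:\{i,j\}\in E(\Gamma))\subseteq R$ be its binomial edge ideal, and let $K_S$ be the complete graph on $S$ (with $K_n=K_{\{1,\dots,n\}}$). **The poset $\mathcal Q_{\mathcal J(\Gamma)}$.** Start with the set of associated primes of $\mathcal J(\Gamma)$. Repeatedly form all sums of finitely many ideals in the current set, keep those sums that are prime, and replace each sum that is not prime by the primes in its primary decomposition. $\mathcal Q_{\mathcal J(\Gamma)}$ consists of all the ideals reached in this way, ordered by reverse inclusion, together with an adjoined maximal element $1$. **The poset $\mathcal P_{\overline G}$.** Let $G$ be a graph on $\{1,\dots,n\}$ of girth at least $5$ (possibly acyclic), with at least one edge and no vertex adjacent to all others, and let $\overline G$ be its complement. Write $N_G(v)$ and $N_G[v]=N_G(v)\cup\{v\}$ for the open and closed neighbourhoods of $v$. Let $H$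 be the subgraph of $G$ obtained by removing all leaves and all isolated vertices of $G$. For a graph $\Gamma$ let $F(\Gamma)$ be the set of those edges of $\Gamma$ that form a connected component of $\Gamma$. A star is a graph with a vertex joined to all other vertices and no further edges; a single vertex and a single edge are stars. The ideals in $\mathcal P_{\overline G}$ are - $\mathfrak j=\mathcal J(K_n)$; - $\mathfrak a_v=(x_i,y_i:i\notin N_G[v])+\mathcal J(K_{N_G(v)})$ and $\mathfrak b_v=(x_i,y_i:i\notin N_G[v])+\mathcal J(K_{N_G[v]})$ for $v\in V(H)$; - $\mathfrak a'_{\{v,w\}}=(x_i,y_i:i\notin\{v,w\})$ and $\mathfrak b'_{\{v,w\}}=(x_i,y_i:i\notin\{v,w\})+(\delta_{v,w})$ for $\{v,w\}\in F(G)$; - $\mathfrak c_{\{v,w\}}=(x_i,y_i:i\notin\{v,w\})$ and $\mathfrak d_{\{v,w\}}=(x_i,y_i:i\notin\{v,w\})+(\delta_{v,w})$ for $\{v,w\}\in E(H)$; - $\mathfrak e_v=(x_i,y_i:i\neq v)$ for $v\in V(H)$ with $|N_H(v)|>1$; - $\mathfrak m$, exactly when $|F(G)|\ge 2$, or $V(H)\ne\varnothing$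 and either $F(G)\neq\varnothing$ or $H$ is not a star. An element $1$ is adjoined, and the order of $\mathcal P_{\overline G}$ is the reflexive and transitive closure of the following relations (for all indices for which the elements are defined): - $\mathfrak m\le\mathfrak b'_{\{v,w\}}$ and $\mathfrak m\le\mathfrak e_v$; - $\mathfrak m\le\mathfrak d_{\{v,w\}}$ if $\{v,w\}\in F(H)$, and $\mathfrak m\le\mathfrak b_v$ if $v$ is an isolated vertex of $H$; - $\mathfrak e_v\le\mathfrak d_{\{v,w\}}$ for $w\in N_H(v)$; - $\mathfrak d_{\{v,w\}}\le\mathfrak b_v,\ \mathfrak b_w,\ \mathfrak c_{\{v,w\}}$; - $\mathfrak c_{\{v,w\}}\le\mathfrak a_v,\ \mathfrak a_w$; - $\mathfrak b'_{\{v,w\}}\le\mathfrak j,\ \mathfrak a'_{\{v,w\}}$; - $\mathfrak b_v\le\mathfrak j,\ \mathfrak a_v$; - $\mathfrak j,\ \mathfrak a_v,\ \mathfrak a'_{\{v,w\}}\le 1$. **Lemma.** $\mathcal Q_{\mathcal J(\overline G)}=\mathcal P_{\overline G}$ as posets: the two have the same elements, and the order generated by the listed relations is reverse inclusion of ideals with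 $1$ as largest element. -/

import Mathlib

open scoped BigOperators

noncomputable section

namespace BinomialEdge

/-! ### Binomial edge ideals -/

/-- The polynomial ring `k[x_1, …, x_n, y_1, …, y_n]`: `Sum.inl i` indexes `x_i` and `Sum.inr i`
indexes `y_i`. -/
abbrev PolyRing (k : Type*) [Field k] (n : ℕ) : Type _ := MvPolynomial (Fin n ⊕ Fin n) k

variable (k : Type*) [Field k] {n : ℕ}

/-- The variable `x_i`. -/
def x (i : Fin n) : PolyRing k n := MvPolynomial.X (Sum.inl i)

/-- The variable `y_i`. -/
def y (i : Fin n) : PolyRing k n := MvPolynomial.X (Sum.inr i)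

/-- The binomial `δ_{i,j} = x_i y_j - x_j y_i`. -/
def delta (i j : Fin n) : PolyRing k n := x k i * y k j - x k j * y k i

/-- The binomial edge ideal `J(G) = (δ_{i,j} : {i,j} ∈ E(G))`. Both orderings of an edge are
listed; as `δ_{j,i} = -δ_{i,j}` this does not change the ideal. -/
def edgeIdeal (G : SimpleGraph (Fin n)) : Ideal (PolyRing k n) :=
  Ideal.span {f | ∃ i j, G.Adj i j ∧ f = delta k i j}

/-- The ideal `(x_i, y_i : i ∈ S)`. -/
def varIdeal (S : Set (Fin n)) : Ideal (PolyRing k n) :=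
  Ideal.span {f | ∃ i ∈ S, f = x k i ∨ f = y k i}

/-- The complete graph `K_S` on the vertices in `S` (the vertices outside `S` carry no edge, so
they do not contribute to the ideal `J(K_S)` of the polynomial ring). -/
def completeOn (S : Set (Fin n)) : SimpleGraph (Fin n) :=
  SimpleGraph.fromRel fun i j => i ∈ S ∧ j ∈ S

/-! ### Àlvarez Montaner's poset -/

/-- One round of the construction: form all sums of finitely many ideals from the set `A`; keep the
sums that are prime, and replace each sum that is not prime by the primes in its primary
decomposition (its associated primes). As the sums of one term are among them, a set of primes `A`
is contained in `sumStep k A`. -/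
def sumStep (A : Set (Ideal (PolyRing k n))) : Set (Ideal (PolyRing k n)) :=
  {p | ∃ s : Finset (Ideal (PolyRing k n)), s.Nonempty ∧ (∀ I ∈ s, I ∈ A) ∧
    (((∑ I ∈ s, I).IsPrime ∧ p = ∑ I ∈ s, I) ∨
      (¬ (∑ I ∈ s, I).IsPrime ∧
        p ∈ associatedPrimes (PolyRing k n) (PolyRing k n ⧸ (∑ I ∈ s, I))))}

/-- The ideals reached from the associated primes of `J(G)` after finitely many rounds. -/
def qIdeals (G : SimpleGraph (Fin n)) : Set (Ideal (PolyRing k n)) :=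
  ⋃ m : ℕ, (sumStep k)^[m] (associatedPrimes (PolyRing k n) (PolyRing k n ⧸ edgeIdeal k G))

/-- All ideals of the polynomial ring ordered by reverse inclusion, with a new largest element
`⊤` adjoined. -/
abbrev RevIdeals (n : ℕ) : Type _ := WithTop (Ideal (PolyRing k n))ᵒᵈ

variable {k} in
/-- An ideal as an element of `RevIdeals k n`. -/
def elt (I : Ideal (PolyRing k n)) : RevIdeals k n :=
  ((OrderDual.toDual I : (Ideal (PolyRing k n))ᵒᵈ) : RevIdeals k n)

/-- The elements of the poset `Q_{J(G)}`; its order is the one of `RevIdeals k n`, that is, reverse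
inclusion of ideals, with an adjoined maximal element. -/
def qPoset (G : SimpleGraph (Fin n)) : Set (RevIdeals k n) :=
  insert ⊤ (elt '' qIdeals k G)

/-! ### Graph notions -/

/-- The subgraph of `G` obtained by removing all leaves and all isolated vertices of `G`. -/
def core (G : SimpleGraph (Fin n)) : G.Subgraph :=
  (⊤ : G.Subgraph).deleteVerts
    {v | (G.neighborSet v).ncard = 1 ∨ (G.neighborSet v).ncard = 0}

/-- `F(G)`: the edges of `G` that form a connected component of their own. -/
def freeEdges (G : SimpleGraph (Fin n)) : Set (Sym2 (Fin n)) :=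
  {e | e ∈ G.edgeSet ∧ ∃ C : G.ConnectedComponent, C.supp = (e : Set (Fin n))}

/-- A subgraph is a star if some vertex is joined to all others and there are no further edges
(a single vertex and a single edge are stars). -/
def IsStar {G : SimpleGraph (Fin n)} (H : G.Subgraph) : Prop :=
  ∃ c : H.verts, H.coe = SimpleGraph.starGraph c

/-- The closed neighbourhood `N_G[v]`. -/
def closedNbr (G : SimpleGraph (Fin n)) (v : Fin n) : Set (Fin n) :=
  insert v (G.neighborSet v)

/-! ### The explicit poset -/

/-- `𝔧 = J(K_n)`. -/
def jI (n : ℕ) : Ideal (PolyRing k n) := edgeIdeal k ⊤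

/-- `𝔞_v`. -/
def aI (G : SimpleGraph (Fin n)) (v : Fin n) : Ideal (PolyRing k n) :=
  varIdeal k (closedNbr G v)ᶜ + edgeIdeal k (completeOn (G.neighborSet v))

/-- `𝔞'_{v,w}`. -/
def aI' (v w : Fin n) : Ideal (PolyRing k n) := varIdeal k ({v, w} : Set (Fin n))ᶜ

/-- `𝔟_v`. -/
def bI (G : SimpleGraph (Fin n)) (v : Fin n) : Ideal (PolyRing k n) :=
  varIdeal k (closedNbr G v)ᶜ + edgeIdeal k (completeOn (closedNbr G v))

/-- `𝔟'_{v,w}`. -/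
def bI' (v w : Fin n) : Ideal (PolyRing k n) :=
  varIdeal k ({v, w} : Set (Fin n))ᶜ + Ideal.span {delta k v w}

/-- `𝔠_{v,w}`. -/
def cI (v w : Fin n) : Ideal (PolyRing k n) := varIdeal k ({v, w} : Set (Fin n))ᶜ

/-- `𝔡_{v,w}`. -/
def dI (v w : Fin n) : Ideal (PolyRing k n) :=
  varIdeal k ({v, w} : Set (Fin n))ᶜ + Ideal.span {delta k v w}

/-- `𝔢_v`. -/
def eI (v : Fin n) : Ideal (PolyRing k n) := varIdeal k ({v} : Set (Fin n))ᶜ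

/-- The irrelevant ideal `𝔪`, generated by all variables. -/
def mI (n : ℕ) : Ideal (PolyRing k n) := Ideal.span (Set.range MvPolynomial.X)

/-- The condition under which `𝔪` belongs to the poset: `|F(G)| ≥ 2`, or `V(H) ≠ ∅` and either
`F(G) ≠ ∅` or `H` is not a star. -/
def HasM (G : SimpleGraph (Fin n)) : Prop :=
  2 ≤ (freeEdges G).ncard ∨
    ((core G).verts.Nonempty ∧ ((freeEdges G).Nonempty ∨ ¬ IsStar (core G)))

/-- The ideals in the poset `P` of the complement of `G`. -/
inductive PIdeal (G : SimpleGraph (Fin n)) : Ideal (PolyRing k n) → Prop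
  | j : PIdeal G (jI k n)
  | a (v : Fin n) (hv : v ∈ (core G).verts) : PIdeal G (aI k G v)
  | a' (v w : Fin n) (h : s(v, w) ∈ freeEdges G) : PIdeal G (aI' k v w)
  | b (v : Fin n) (hv : v ∈ (core G).verts) : PIdeal G (bI k G v)
  | b' (v w : Fin n) (h : s(v, w) ∈ freeEdges G) : PIdeal G (bI' k v w)
  | c (v w : Fin n) (h : (core G).Adj v w) : PIdeal G (cI k v w)
  | d (v w : Fin n) (h : (core G).Adj v w) : PIdeal G (dI k v w)
  | e (v : Fin n) (hv : v ∈ (core G).verts) (h : 1 < ((core G).neighborSet v).ncard) :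
      PIdeal G (eI k v)
  | m (h : HasM G) : PIdeal G (mI k n)

/-- The elements of the poset `P`: the ideals above and an adjoined element `⊤`. -/
def pPoset (G : SimpleGraph (Fin n)) : Set (RevIdeals k n) :=
  insert ⊤ (elt '' {I | PIdeal k G I})

/-- The listed relations that generate the order of `P`. -/
inductive PRel (G : SimpleGraph (Fin n)) : RevIdeals k n → RevIdeals k n → Prop
  | m_b' (hm : HasM G) (v w : Fin n) (h : s(v, w) ∈ freeEdges G) :
      PRel G (elt (mI k n)) (elt (bI' k v w))
  | m_e (hm : HasM G) (v : Fin n) (hv : v ∈ (core G).verts)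
      (h : 1 < ((core G).neighborSet v).ncard) :
      PRel G (elt (mI k n)) (elt (eI k v))
  /-- `𝔪 ≤ 𝔡_{v,w}` if `{v, w}` is a connected component of `H`. -/
  | m_d (hm : HasM G) (v w : Fin n) (h : (core G).neighborSet v = {w})
      (h' : (core G).neighborSet w = {v}) :
      PRel G (elt (mI k n)) (elt (dI k v w))
  /-- `𝔪 ≤ 𝔟_v` if `v` is an isolated vertex of `H`. -/
  | m_b (hm : HasM G) (v : Fin n) (hv : v ∈ (core G).verts)
      (h : (core G).neighborSet v = ∅) :
      PRel G (elt (mI k n)) (elt (bI k G v))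
  | e_d (v w : Fin n) (h : 1 < ((core G).neighborSet v).ncard) (hw : (core G).Adj v w) :
      PRel G (elt (eI k v)) (elt (dI k v w))
  | d_b_left (v w : Fin n) (h : (core G).Adj v w) : PRel G (elt (dI k v w)) (elt (bI k G v))
  | d_b_right (v w : Fin n) (h : (core G).Adj v w) : PRel G (elt (dI k v w)) (elt (bI k G w))
  | d_c (v w : Fin n) (h : (core G).Adj v w) : PRel G (elt (dI k v w)) (elt (cI k v w))
  | c_a_left (v w : Fin n) (h : (core G).Adj v w) : PRel G (elt (cI k v w)) (elt (aI k G v))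
  | c_a_right (v w : Fin n) (h : (core G).Adj v w) : PRel G (elt (cI k v w)) (elt (aI k G w))
  | b'_j (v w : Fin n) (h : s(v, w) ∈ freeEdges G) : PRel G (elt (bI' k v w)) (elt (jI k n))
  | b'_a' (v w : Fin n) (h : s(v, w) ∈ freeEdges G) : PRel G (elt (bI' k v w)) (elt (aI' k v w))
  | b_j (v : Fin n) (hv : v ∈ (core G).verts) : PRel G (elt (bI k G v)) (elt (jI k n))
  | b_a (v : Fin n) (hv : v ∈ (core G).verts) : PRel G (elt (bI k G v)) (elt (aI k G v))
  | j_top : PRel G (elt (jI k n)) ⊤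
  | a_top (v : Fin n) (hv : v ∈ (core G).verts) : PRel G (elt (aI k G v)) ⊤
  | a'_top (v w : Fin n) (h : s(v, w) ∈ freeEdges G) : PRel G (elt (aI' k v w)) ⊤

/-- The order of `P`: the reflexive and transitive closure of the listed relations. -/
def pLE (G : SimpleGraph (Fin n)) : RevIdeals k n → RevIdeals k n → Prop :=
  Relation.ReflTransGen (PRel k G)

end BinomialEdge

end

noncomputable section

namespace BinomialEdge

open MvPolynomial

/-! Every ideal that occurs has the form `std k T E`: the variables of all vertices outside a
support `T`, together with the binomials of a relation `E`. Evaluating at 0/1 points shows that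
inclusion of two such ideals is a combinatorial condition on supports and relations
(`std_le_std_iff`), and a sum intersects the supports and unites the relations (`std_sup_std`). If
`E` restricted to `T` is, up to symmetry and the diagonal, an equivalence relation, then the ideal
is the kernel of the monomial map `x_i ↦ a_i s_{c(i)}`, `y_i ↦ a_i t_{c(i)}` into a polynomial ring,
hence prime (`ker_param`, `std_isPrime`).

The associated primes of `J(Gᶜ)` are 𝔧, the 𝔞_v and the 𝔞'_{v,w}. To see that `J(Gᶜ)` is their
intersection, split a polynomial into its multidegrees `d`. As `G` has no 4-cycle, the support of
`d` is either connected in `Gᶜ` or has a vertex joined in `G` to all its other vertices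
(`compl_connected_or_star`). In the first case membership in 𝔧 puts the part of degree `d` into
`J(Gᶜ)`; in the second, membership in some 𝔞_v or 𝔞'_{v,w} does, because without triangles the
remaining vertices of the star are pairwise adjacent in `Gᶜ`. These primes form an antichain, so
they are exactly the associated primes (`associatedPrimes_edgeIdeal_compl`).

Girth at least 5 also controls the sums: two closed neighbourhoods of distinct core vertices meet in
an edge, in one vertex or not at all, giving 𝔠, 𝔢 or 𝔪, and adding 𝔧 turns 𝔞, 𝔞', 𝔠 into 𝔟, 𝔟', 𝔡.
Hence the listed ideals are closed under sums (`PIdeal.sup`), and each is a sum of minimal primes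
(`PIdeal.isSum`). All are prime, so the construction never has to decompose anything and stabilises
after one round (`sumStep_eq`).

For the order, each generating relation is an inclusion; conversely, supports and relations leave
few possible inclusions, and each is realised by a chain of generators (`pLE_of_le`). -/

/-! ### Homomorphisms that send monomials to monomials -/

/-- Let `φ` send the monomials in `D` to monomials, and the others to `0` or to monomials that are
not images of monomials in `D`. If monomials in `D` with the same image are congruent modulo `J`,
then the `D`-part of every element of the kernel of `φ` lies in `J`. -/
theorem sum_filter_mem_of_map_eq_zero {K σ τ : Type*} [Field K]
    (φ : MvPolynomial σ K →ₐ[K] MvPolynomial τ K) (g : (σ →₀ ℕ) → (τ →₀ ℕ))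
    (D : (σ →₀ ℕ) → Prop) [DecidablePred D] (J : Ideal (MvPolynomial σ K))
    (hD : ∀ m, D m → φ (monomial m 1) = monomial (g m) 1)
    (hout : ∀ m, ¬ D m → φ (monomial m 1) = 0 ∨
      ∃ μ, φ (monomial m 1) = monomial μ 1 ∧ ∀ m', D m' → g m' ≠ μ)
    (hJ : ∀ m m', D m → D m' → g m = g m' →
      (monomial m 1 - monomial m' 1 : MvPolynomial σ K) ∈ J)
    (f : MvPolynomial σ K) (hf : φ f = 0) :
    ∑ m ∈ f.support with D m, monomial m (coeff m f) ∈ J := by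
  classical
  -- A linear map back to the quotient: a monomial goes to the class of a chosen preimage in `D`, or
  -- to 0 if there is none. The choice is harmless by `hJ`, and composing with `φ` gives the
  -- projection to the `D`-part modulo `J`.
  let rep : (τ →₀ ℕ) → MvPolynomial σ K ⧸ J := fun μ =>
    if h : ∃ m, D m ∧ g m = μ then Ideal.Quotient.mk J (monomial h.choose 1) else 0
  let s : MvPolynomial τ K →ₗ[K] MvPolynomial σ K ⧸ J :=
    (basisMonomials τ K).constr K rep
  have hs : ∀ μ, s (monomial μ 1) = rep μ := fun μ => by
    have := (basisMonomials τ K).constr_basis K rep μ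
    simpa [s] using this
  have key : ∀ m c, s (φ (monomial m c)) =
      if D m then Ideal.Quotient.mk J (monomial m c) else 0 := by
    intro m c
    have e : (monomial m c : MvPolynomial σ K) = c • monomial m 1 := by
      rw [smul_monomial, smul_eq_mul, mul_one]
    have e2 : Ideal.Quotient.mk J (c • monomial m 1) =
        c • Ideal.Quotient.mk J (monomial m 1) := rfl
    rw [e, map_smul, map_smul, e2]
    split_ifs with h
    · congr 1
      rw [hD m h, hs]
      have hex : ∃ m', D m' ∧ g m' = g m := ⟨m, h, rfl⟩
      simp only [rep, dif_pos hex]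
      rw [Ideal.Quotient.eq]
      exact hJ _ _ hex.choose_spec.1 h hex.choose_spec.2
    · rcases hout m h with h0 | ⟨μ, h1, h2⟩
      · rw [h0, map_zero, smul_zero]
      · rw [h1, hs]
        have hex : ¬ ∃ m', D m' ∧ g m' = μ := by
          rintro ⟨m', a, b⟩
          exact h2 m' a b
        simp only [rep, dif_neg hex, smul_zero]
  rw [← Ideal.Quotient.eq_zero_iff_mem, map_sum, Finset.sum_filter]
  have h0 : s (φ f) = 0 := by rw [hf, map_zero]
  rw [f.as_sum, map_sum, map_sum] at h0
  refine Eq.trans ?_ h0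
  exact Finset.sum_congr rfl fun m _ => (key m _).symm

variable {k : Type*} [Field k] {n : ℕ}

/-! ### Multidegrees and swaps -/

/-- The vertex to which a variable belongs. -/
def vtx (v : Fin n ⊕ Fin n) : Fin n := v.elim id id

/-- The `ℕⁿ`-degree of a monomial, where `x_i` and `y_i` both have degree `e_i`. -/
def dg (m : Fin n ⊕ Fin n →₀ ℕ) (i : Fin n) : ℕ := m (Sum.inl i) + m (Sum.inr i)

theorem dg_add (m m' : Fin n ⊕ Fin n →₀ ℕ) (i : Fin n) : dg (m + m') i = dg m i + dg m' i := by
  simp only [dg, Finsupp.add_apply]; ring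

theorem dg_inl (j i : Fin n) : dg (Finsupp.single (Sum.inl j) 1) i = if j = i then 1 else 0 := by
  simp [dg, Finsupp.single_apply]

theorem dg_inr (j i : Fin n) : dg (Finsupp.single (Sum.inr j) 1) i = if j = i then 1 else 0 := by
  simp [dg, Finsupp.single_apply]

theorem exists_eq_add_single {σ : Type*} (m : σ →₀ ℕ) (v : σ) (h : m v ≠ 0) :
    ∃ u, m = u + Finsupp.single v 1 := by
  refine ⟨m - Finsupp.single v 1, ?_⟩
  rw [tsub_add_cancel_of_le]
  rw [Finsupp.single_le_iff]
  omega

variable (k) in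
theorem monomial_add_inl (u : Fin n ⊕ Fin n →₀ ℕ) (i : Fin n) :
    (monomial (u + Finsupp.single (Sum.inl i) 1) 1 : PolyRing k n) = monomial u 1 * x k i := by
  rw [x, X, monomial_mul, one_mul]

variable (k) in
theorem monomial_add_inr (u : Fin n ⊕ Fin n →₀ ℕ) (i : Fin n) :
    (monomial (u + Finsupp.single (Sum.inr i) 1) 1 : PolyRing k n) = monomial u 1 * y k i := by
  rw [y, X, monomial_mul, one_mul]

/-- Monomials of the same multidegree with the same number of `x`-factors in each class of `c` are
congruent modulo an ideal that contains all swaps inside the classes. -/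
theorem monomial_sub_mem_of_swaps {L : Type*} (c : Fin n → L) [DecidableEq L]
    (J : Ideal (PolyRing k n)) (d : Fin n → ℕ)
    (hsw : ∀ i j u, i ≠ j → c i = c j →
      dg (u + Finsupp.single (Sum.inl i) 1 + Finsupp.single (Sum.inr j) 1) = d →
      monomial u 1 * x k i * y k j - monomial u 1 * x k j * y k i ∈ J) :
    ∀ (N : ℕ) (m m' : Fin n ⊕ Fin n →₀ ℕ), ∑ i, (m (Sum.inl i) - m' (Sum.inl i)) ≤ N →
      dg m = d → dg m' = d →
      (∀ l, ∑ i with c i = l, m (Sum.inl i) = ∑ i with c i = l, m' (Sum.inl i)) →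
      (monomial m 1 - monomial m' 1 : PolyRing k n) ∈ J := by
  -- The induction runs over the total excess of the `x`-exponents of `m` over those of `m'`;
  -- truncated subtraction counts only positive differences.
  intro N
  induction N with
  | zero =>
    intro m m' hN hm hm' hl
    have hle : ∀ i, m (Sum.inl i) ≤ m' (Sum.inl i) := by
      intro i
      have := (Finset.sum_eq_zero_iff.1 (Nat.le_zero.1 hN)) i (Finset.mem_univ i)
      omega
    have heq : ∀ i, m (Sum.inl i) = m' (Sum.inl i) := fun i =>
      (Finset.sum_eq_sum_iff_of_le (fun j _ => hle j)).1 (hl (c i)) i (by simp)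
    have : m = m' := by
      ext v
      rcases v with i | i
      · exact heq i
      · have h1 := congrFun (hm.trans hm'.symm) i
        have h2 := heq i
        simp only [dg] at h1
        omega
    rw [this, sub_self]
    exact J.zero_mem
  | succ N ih =>
    intro m m' hN hm hm' hl
    by_cases hle : ∑ i, (m (Sum.inl i) - m' (Sum.inl i)) ≤ N
    · exact ih m m' hle hm hm' hl
    -- Some `x_i` is in excess, and equal class totals force a deficit of some `x_j` in the same
    -- class. Equal multidegrees then make `y_j` divide `m`, so exchanging `x_i y_j` for `x_j y_i`
    -- is possible and lowers the excess.
    obtain ⟨i, hi⟩ : ∃ i, m' (Sum.inl i) < m (Sum.inl i) := by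
      by_contra! hcon
      apply hle
      rw [Finset.sum_eq_zero]
      · omega
      · intro i _
        have := hcon i
        omega
    obtain ⟨j, hcj, hj⟩ : ∃ j, c j = c i ∧ m (Sum.inl j) < m' (Sum.inl j) := by
      by_contra! hcon
      have := Finset.sum_lt_sum (s := Finset.univ.filter fun j => c j = c i)
        (f := fun j => m' (Sum.inl j)) (g := fun j => m (Sum.inl j))
        (fun j hj => hcon j (by simpa using hj)) ⟨i, by simp, hi⟩
      exact this.ne' (hl (c i))
    have hij : i ≠ j := by rintro rfl; omega
    have hdj := congrFun (hm.trans hm'.symm) j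
    simp only [dg] at hdj
    obtain ⟨u₁, hu₁⟩ := exists_eq_add_single m (Sum.inr j) (by omega)
    obtain ⟨u, hu⟩ := exists_eq_add_single u₁ (Sum.inl i) (by
      have : m (Sum.inl i) = u₁ (Sum.inl i) := by rw [hu₁]; simp
      omega)
    subst hu
    have hmem := hsw i j u hij hcj.symm (by rw [← hu₁, hm])
    set m₂ := u + Finsupp.single (Sum.inl j) 1 + Finsupp.single (Sum.inr i) 1 with hm₂
    have e1 : (monomial m 1 : PolyRing k n) = monomial u 1 * x k i * y k j := by
      rw [hu₁, monomial_add_inr, monomial_add_inl]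
    have e2 : (monomial m₂ 1 : PolyRing k n) = monomial u 1 * x k j * y k i := by
      rw [hm₂, monomial_add_inr, monomial_add_inl]
    have hx : ∀ a, m₂ (Sum.inl a) + (if i = a then 1 else 0) =
        m (Sum.inl a) + (if j = a then 1 else 0) := by
      intro a
      rw [hm₂, hu₁]
      simp [Finsupp.single_apply]
      ring
    have h3 : (monomial m₂ 1 - monomial m' 1 : PolyRing k n) ∈ J := by
      apply ih
      · have hlt : ∑ a, (m₂ (Sum.inl a) - m' (Sum.inl a)) <
            ∑ a, (m (Sum.inl a) - m' (Sum.inl a)) := by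
          apply Finset.sum_lt_sum
          · intro a _
            have := hx a
            by_cases hja : j = a
            · subst hja
              rw [if_neg hij, if_pos rfl] at this
              omega
            · rw [if_neg hja] at this
              omega
          · refine ⟨i, Finset.mem_univ _, ?_⟩
            have := hx i
            rw [if_pos rfl, if_neg hij.symm] at this
            omega
        omega
      · rw [← hm]
        funext a
        rw [hm₂, hu₁]
        simp only [dg_add, dg_inl, dg_inr]
        ring
      · exact hm'
      · intro l
        rw [← hl l]
        have h4 := Finset.sum_congr (s₁ := Finset.univ.filter fun a => c a = l) rfl
          (fun a _ => hx a)
        rw [Finset.sum_add_distrib, Finset.sum_add_distrib] at h4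
        simp only [Finset.sum_ite_eq, Finset.mem_filter, Finset.mem_univ, true_and, hcj] at h4
        omega
    have := J.add_mem hmem h3
    rwa [← e1, ← e2, sub_add_sub_cancel] at this

/-- Swaps along a path of `Γ` inside the support of a monomial do not change its class modulo the
binomial edge ideal. -/
theorem swap_mem_edgeIdeal (Γ : SimpleGraph (Fin n)) (d : Fin n → ℕ) {i j : Fin n}
    (h : Relation.ReflTransGen (fun a b => Γ.Adj a b ∧ 0 < d a ∧ 0 < d b) i j) :
    ∀ u, dg (u + Finsupp.single (Sum.inl i) 1 + Finsupp.single (Sum.inr j) 1) = d →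
      monomial u 1 * x k i * y k j - monomial u 1 * x k j * y k i ∈ edgeIdeal k Γ := by
  induction h using Relation.ReflTransGen.head_induction_on with
  | refl =>
    intro u _
    rw [sub_self]
    exact Ideal.zero_mem _
  | head hac hcb ih =>
    rename_i i l
    intro u hu
    have hδ : delta k i l ∈ edgeIdeal k Γ := Ideal.subset_span ⟨i, l, hac.1, rfl⟩
    by_cases hlj : l = j
    · subst hlj
      have : monomial u 1 * x k i * y k l - monomial u 1 * x k l * y k i =
          monomial u 1 * delta k i l := by rw [delta]; ring
      rw [this]
      exact Ideal.mul_mem_left _ _ hδ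
    have hil : i ≠ l := hac.1.ne
    -- The intermediate vertex `l` differs from `i` and `j`, so its positive degree must come from
    -- `u`. A factor `x_l` or `y_l` of `u` then carries the swap: `x_l δ_{i,j} = x_i δ_{l,j} + x_j
    -- δ_{i,l}`, and likewise with `y`.
    have hpos : 0 < dg u l := by
      have := hac.2.2
      rw [← hu] at this
      simp only [dg_add, dg_inl, dg_inr, if_neg hil, if_neg (Ne.symm hlj)] at this
      simpa using this
    by_cases hy : u (Sum.inr l) = 0
    · obtain ⟨u', rfl⟩ := exists_eq_add_single u (Sum.inl l) (by
        rw [dg] at hpos; omega)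
      have h1 := ih (u' + Finsupp.single (Sum.inl i) 1) (by
        rw [← hu]; congr 1; abel)
      rw [monomial_add_inl] at h1 ⊢
      have h2 := Ideal.mul_mem_left _ (monomial u' 1 * x k j) hδ
      have := Ideal.add_mem _ h1 h2
      convert this using 1
      rw [delta]; ring
    · obtain ⟨u', rfl⟩ := exists_eq_add_single u (Sum.inr l) hy
      have h1 := ih (u' + Finsupp.single (Sum.inr i) 1) (by
        rw [← hu]
        funext a
        simp only [dg_add, dg_inl, dg_inr]
        ring)
      rw [monomial_add_inr] at h1 ⊢
      have h2 := Ideal.mul_mem_left _ (monomial u' 1 * y k j) hδ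
      have := Ideal.add_mem _ h1 h2
      convert this using 1
      rw [delta]; ring

/-! ### The ideals generated by variables and binomials -/

section Std

variable (k : Type*) [Field k] {n : ℕ}

/-- The ideal `(x_i, y_i : i ∉ T) + (δ_{i,j} : E i j)`. -/
def std (T : Set (Fin n)) (E : Fin n → Fin n → Prop) : Ideal (PolyRing k n) :=
  varIdeal k Tᶜ ⊔ Ideal.span {f | ∃ i j, E i j ∧ f = delta k i j}

variable {k}

theorem x_mem_std {T : Set (Fin n)} {E : Fin n → Fin n → Prop} {i : Fin n} (h : i ∉ T) :
    x k i ∈ std k T E :=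
  Ideal.mem_sup_left (Ideal.subset_span ⟨i, h, Or.inl rfl⟩)

theorem y_mem_std {T : Set (Fin n)} {E : Fin n → Fin n → Prop} {i : Fin n} (h : i ∉ T) :
    y k i ∈ std k T E :=
  Ideal.mem_sup_left (Ideal.subset_span ⟨i, h, Or.inr rfl⟩)

theorem delta_mem_std {T : Set (Fin n)} {E : Fin n → Fin n → Prop} {i j : Fin n} (h : E i j) :
    delta k i j ∈ std k T E :=
  Ideal.mem_sup_right (Ideal.subset_span ⟨i, j, h, rfl⟩)

theorem delta_swap (i j : Fin n) : delta k j i = -delta k i j := by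
  simp only [delta]; ring

theorem delta_mem_std_of_or {T : Set (Fin n)} {E : Fin n → Fin n → Prop} {i j : Fin n}
    (h : E i j ∨ E j i) : delta k i j ∈ std k T E := by
  rcases h with h | h
  · exact delta_mem_std h
  · rw [delta_swap]
    exact neg_mem (delta_mem_std h)

theorem std_le_iff_forall {T : Set (Fin n)} {E : Fin n → Fin n → Prop} {I : Ideal (PolyRing k n)} :
    std k T E ≤ I ↔ (∀ i ∉ T, x k i ∈ I ∧ y k i ∈ I) ∧ ∀ i j, E i j → delta k i j ∈ I := by
  rw [std, sup_le_iff, varIdeal, Ideal.span_le, Ideal.span_le]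
  constructor
  · rintro ⟨h1, h2⟩
    exact ⟨fun i hi => ⟨h1 ⟨i, hi, Or.inl rfl⟩, h1 ⟨i, hi, Or.inr rfl⟩⟩,
      fun i j h => h2 ⟨i, j, h, rfl⟩⟩
  · rintro ⟨h1, h2⟩
    constructor
    · rintro f ⟨i, hi, rfl | rfl⟩
      · exact (h1 i hi).1
      · exact (h1 i hi).2
    · rintro f ⟨i, j, h, rfl⟩
      exact h2 i j h

/-- For `i ∈ T`, the point with `x_i = 1` and all other coordinates 0 is a zero of the ideal but not
of `x_i`. -/
theorem not_mem_of_x_mem_std {T : Set (Fin n)} {E : Fin n → Fin n → Prop} {i : Fin n}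
    (h : x k i ∈ std k T E) : i ∉ T := by
  intro hi
  let ev : PolyRing k n →+* k := eval (Sum.elim (fun a => if a = i then 1 else 0) fun _ => 0)
  have hle : std k T E ≤ RingHom.ker ev := by
    rw [std_le_iff_forall]
    constructor
    · intro a ha
      have : a ≠ i := by rintro rfl; exact ha hi
      simp [RingHom.mem_ker, ev, x, y, this]
    · intro a b _
      simp [RingHom.mem_ker, ev, x, y, delta]
  have := hle h
  simp [RingHom.mem_ker, ev, x] at this

/-- At the point `x_i = y_j = 1` with all other coordinates 0, the only binomials of distinct
vertices that survive are `δ_{i,j}` and `δ_{j,i}`. -/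
theorem rel_of_delta_mem_std {T : Set (Fin n)} {E : Fin n → Fin n → Prop} {i j : Fin n}
    (h : delta k i j ∈ std k T E) (hij : i ≠ j) (hi : i ∈ T) (hj : j ∈ T) : E i j ∨ E j i := by
  by_contra! hcon
  let ev : PolyRing k n →+* k :=
    eval (Sum.elim (fun a => if a = i then 1 else 0) fun a => if a = j then 1 else 0)
  have hle : std k T E ≤ RingHom.ker ev := by
    rw [std_le_iff_forall]
    constructor
    · intro a ha
      have h1 : a ≠ i := by rintro rfl; exact ha hi
      have h2 : a ≠ j := by rintro rfl; exact ha hj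
      simp [RingHom.mem_ker, ev, x, y, h1, h2]
    · intro a b hab
      have h1 : ¬ (a = i ∧ b = j) := by rintro ⟨rfl, rfl⟩; exact hcon.1 hab
      have h2 : ¬ (b = i ∧ a = j) := by rintro ⟨rfl, rfl⟩; exact hcon.2 hab
      simp only [RingHom.mem_ker, ev, x, y, delta, map_sub, map_mul, eval_X, Sum.elim_inl,
        Sum.elim_inr]
      by_cases e1 : a = i <;> by_cases e2 : b = j <;> by_cases e3 : b = i <;>
        by_cases e4 : a = j <;> simp_all
  have := hle h
  simp [RingHom.mem_ker, ev, x, y, delta, hij, hij.symm] at this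

/-- The dictionary between ideals and combinatorics. A binomial with a vertex outside `T'` already
lies in the larger ideal, which is why the relations are compared only on `T'`. -/
theorem std_le_std_iff {T T' : Set (Fin n)} {E E' : Fin n → Fin n → Prop} :
    std k T E ≤ std k T' E' ↔
      T' ⊆ T ∧ ∀ i j, E i j → i ≠ j → i ∈ T' → j ∈ T' → E' i j ∨ E' j i := by
  constructor
  · intro h
    refine ⟨fun i hi => ?_, fun i j hE hij hi hj => ?_⟩
    · by_contra hcon
      exact not_mem_of_x_mem_std (h (x_mem_std hcon)) hi
    · exact rel_of_delta_mem_std (h (delta_mem_std hE)) hij hi hj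
  · rintro ⟨h1, h2⟩
    rw [std_le_iff_forall]
    refine ⟨fun i hi => ⟨x_mem_std fun h => hi (h1 h), y_mem_std fun h => hi (h1 h)⟩,
      fun i j hE => ?_⟩
    by_cases hij : i = j
    · subst hij
      rw [delta, sub_self]
      exact Ideal.zero_mem _
    by_cases hi : i ∈ T'
    · by_cases hj : j ∈ T'
      · exact delta_mem_std_of_or (h2 i j hE hij hi hj)
      · exact sub_mem (Ideal.mul_mem_left _ _ (y_mem_std hj))
          (Ideal.mul_mem_right _ _ (x_mem_std hj))
    · exact sub_mem (Ideal.mul_mem_right _ _ (x_mem_std hi))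
          (Ideal.mul_mem_left _ _ (y_mem_std hi))

theorem std_sup_std (T T' : Set (Fin n)) (E E' : Fin n → Fin n → Prop) :
    std k T E ⊔ std k T' E' = std k (T ∩ T') (fun i j => E i j ∨ E' i j) := by
  apply le_antisymm
  · rw [sup_le_iff, std_le_std_iff, std_le_std_iff]
    exact ⟨⟨Set.inter_subset_left, fun i j h _ _ _ => Or.inl (Or.inl h)⟩,
      ⟨Set.inter_subset_right, fun i j h _ _ _ => Or.inl (Or.inr h)⟩⟩
  · rw [std_le_iff_forall]
    constructor
    · intro i hi
      by_cases h : i ∈ T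
      · have h' : i ∉ T' := fun h' => hi ⟨h, h'⟩
        exact ⟨Ideal.mem_sup_right (x_mem_std h'), Ideal.mem_sup_right (y_mem_std h')⟩
      · exact ⟨Ideal.mem_sup_left (x_mem_std h), Ideal.mem_sup_left (y_mem_std h)⟩
    · rintro i j (h | h)
      · exact Ideal.mem_sup_left (delta_mem_std h)
      · exact Ideal.mem_sup_right (delta_mem_std h)

theorem std_eq_std_iff {T T' : Set (Fin n)} {E E' : Fin n → Fin n → Prop} :
    std k T E = std k T' E' ↔ T = T' ∧
      (∀ i j, E i j → i ≠ j → i ∈ T → j ∈ T → E' i j ∨ E' j i) ∧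
      ∀ i j, E' i j → i ≠ j → i ∈ T → j ∈ T → E i j ∨ E j i := by
  rw [le_antisymm_iff, std_le_std_iff, std_le_std_iff]
  constructor
  · rintro ⟨⟨h1, h2⟩, h3, h4⟩
    obtain rfl := h3.antisymm h1
    exact ⟨rfl, h2, h4⟩
  · rintro ⟨rfl, h2, h4⟩
    exact ⟨⟨subset_rfl, h2⟩, subset_rfl, h4⟩

theorem edgeIdeal_eq_std (Γ : SimpleGraph (Fin n)) : edgeIdeal k Γ = std k Set.univ Γ.Adj := by
  have : varIdeal k (Set.univ : Set (Fin n))ᶜ = ⊥ := by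
    rw [varIdeal, Ideal.span_eq_bot]
    rintro f ⟨i, hi, -⟩
    exact absurd (Set.mem_univ i) hi
  rw [std, this, bot_sup_eq, edgeIdeal]

end Std

/-! ### The monomial parametrization -/

section Param

variable (k : Type*) [Field k] {n : ℕ} {L : Type*}

/-- The exponent of the image of a variable: `x_i ↦ a_i s_{c(i)}` and `y_i ↦ a_i t_{c(i)}`. -/
def wt (c : Fin n → L) (v : Fin n ⊕ Fin n) : Fin n ⊕ (L ⊕ L) →₀ ℕ :=
  Finsupp.single (Sum.inl (vtx v)) 1 +
    Finsupp.single (Sum.inr (v.elim (fun i => Sum.inl (c i)) fun i => Sum.inr (c i))) 1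

/-- The exponent of the image of a monomial. -/
def img (c : Fin n → L) (m : Fin n ⊕ Fin n →₀ ℕ) : Fin n ⊕ (L ⊕ L) →₀ ℕ :=
  ∑ v, m v • wt c v

open Classical in
/-- The homomorphism `x_i ↦ a_i s_{c(i)}`, `y_i ↦ a_i t_{c(i)}` for `i ∈ T`, and
`x_i, y_i ↦ 0` for `i ∉ T`. -/
def param (T : Set (Fin n)) (c : Fin n → L) :
    PolyRing k n →ₐ[k] MvPolynomial (Fin n ⊕ (L ⊕ L)) k :=
  aeval fun v => if vtx v ∈ T then monomial (wt c v) 1 else 0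

variable {k}

/-- The image of a monomial thus remembers its multidegree and, by `img_inr_inl`, the number of
`x`-factors in each class: exactly the data in `monomial_sub_mem_of_swaps`. -/
theorem img_inl (c : Fin n → L) (m : Fin n ⊕ Fin n →₀ ℕ) (i : Fin n) :
    img c m (Sum.inl i) = dg m i := by
  classical
  simp [img, wt, vtx, dg, Finsupp.single_apply]

theorem img_inr_inl [DecidableEq L] (c : Fin n → L) (m : Fin n ⊕ Fin n →₀ ℕ) (l : L) :
    img c m (Sum.inr (Sum.inl l)) = ∑ i with c i = l, m (Sum.inl i) := by
  simp [img, wt, vtx, Finsupp.single_apply, Finset.sum_filter]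

theorem param_monomial (T : Set (Fin n)) (c : Fin n → L) (m : Fin n ⊕ Fin n →₀ ℕ)
    (hm : ∀ i, dg m i ≠ 0 → i ∈ T) : param k T c (monomial m 1) = monomial (img c m) 1 := by
  classical
  rw [param, aeval_monomial, map_one, one_mul, img, monomial_sum_one, Finsupp.prod_fintype]
  · refine Finset.prod_congr rfl fun v _ => ?_
    by_cases hv : m v = 0
    · simp [hv]
    · have : vtx v ∈ T := by
        apply hm
        rcases v with i | i <;> simp only [vtx, dg, Sum.elim_inl, Sum.elim_inr, id] <;> omega
      rw [if_pos this, monomial_pow, one_pow]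
  · intro v
    exact pow_zero _

theorem param_monomial_eq_zero (T : Set (Fin n)) (c : Fin n → L) (m : Fin n ⊕ Fin n →₀ ℕ)
    {i : Fin n} (hi : dg m i ≠ 0) (hT : i ∉ T) : param k T c (monomial m 1) = 0 := by
  classical
  obtain ⟨v, hv, rfl⟩ : ∃ v, m v ≠ 0 ∧ vtx v = i := by
    by_cases h : m (Sum.inl i) = 0
    · refine ⟨Sum.inr i, ?_, rfl⟩
      rw [dg] at hi
      omega
    · exact ⟨Sum.inl i, h, rfl⟩
  rw [param, aeval_monomial, map_one, one_mul, Finsupp.prod_fintype _ _ fun v => pow_zero _]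
  apply Finset.prod_eq_zero (Finset.mem_univ v)
  rw [if_neg hT, zero_pow hv]

theorem param_X_of_mem {T : Set (Fin n)} (c : Fin n → L) {v : Fin n ⊕ Fin n} (h : vtx v ∈ T) :
    param k T c (X v) = monomial (wt c v) 1 := by
  rw [param, aeval_X, if_pos h]

theorem param_X_of_notMem {T : Set (Fin n)} (c : Fin n → L) {v : Fin n ⊕ Fin n}
    (h : vtx v ∉ T) : param k T c (X v) = 0 := by
  rw [param, aeval_X, if_neg h]

theorem param_delta_eq_zero {T : Set (Fin n)} (c : Fin n → L) {i j : Fin n} (hi : i ∈ T)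
    (hj : j ∈ T) (h : c i = c j) : param k T c (delta k i j) = 0 := by
  have hv : ∀ a ∈ T, param k T c (X (Sum.inl a)) = monomial (wt c (Sum.inl a)) 1 ∧
      param k T c (X (Sum.inr a)) = monomial (wt c (Sum.inr a)) 1 := fun a ha =>
    ⟨param_X_of_mem c ha, param_X_of_mem c ha⟩
  simp only [delta, x, y, map_sub, map_mul, hv i hi, hv j hj]
  have e : wt c (Sum.inl i) + wt c (Sum.inr j) = wt c (Sum.inl j) + wt c (Sum.inr i) := by
    simp only [wt, vtx, Sum.elim_inl, Sum.elim_inr, id, h]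
    ac_rfl
  rw [monomial_mul, monomial_mul, e, sub_self]

theorem std_le_ker_param {T : Set (Fin n)} {c : Fin n → L} {E : Fin n → Fin n → Prop}
    (hE : ∀ i j, i ∈ T → j ∈ T → E i j → c i = c j) :
    std k T E ≤ RingHom.ker (param k T c) := by
  have hx : ∀ i ∉ T, param k T c (x k i) = 0 := fun i hi => param_X_of_notMem c hi
  have hy : ∀ i ∉ T, param k T c (y k i) = 0 := fun i hi => param_X_of_notMem c hi
  rw [std_le_iff_forall]
  refine ⟨fun i hi => ⟨hx i hi, hy i hi⟩, fun i j h => ?_⟩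
  rw [RingHom.mem_ker]
  by_cases hi : i ∈ T
  · by_cases hj : j ∈ T
    · exact param_delta_eq_zero c hi hj (hE i j hi hj h)
    · simp only [delta, map_sub, map_mul, hx j hj, hy j hj, mul_zero, zero_mul, sub_zero]
  · simp only [delta, map_sub, map_mul, hx i hi, hy i hi, mul_zero, zero_mul, sub_zero]

theorem monomial_mem_std {T : Set (Fin n)} {E : Fin n → Fin n → Prop} (m : Fin n ⊕ Fin n →₀ ℕ)
    {i : Fin n} (hi : dg m i ≠ 0) (hT : i ∉ T) (a : k) : monomial m a ∈ std k T E := by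
  by_cases h : m (Sum.inl i) = 0
  · obtain ⟨u, rfl⟩ := exists_eq_add_single m (Sum.inr i) (by rw [dg] at hi; omega)
    have := Ideal.mul_mem_left (std k T E) (monomial u a) (y_mem_std (k := k) hT)
    rwa [y, X, monomial_mul, mul_one] at this
  · obtain ⟨u, rfl⟩ := exists_eq_add_single m (Sum.inl i) h
    have := Ideal.mul_mem_left (std k T E) (monomial u a) (x_mem_std (k := k) hT)
    rwa [x, X, monomial_mul, mul_one] at this

/-- Monomials supported on `T` with the same image differ by swaps inside classes, each a multiple
of some `δ_{i,j}` in the ideal; monomials meeting the complement of `T` lie in the ideal anyway. -/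
theorem ker_param {T : Set (Fin n)} {c : Fin n → L} {E : Fin n → Fin n → Prop}
    (hE : ∀ i j, i ∈ T → j ∈ T → i ≠ j → (E i j ∨ E j i ↔ c i = c j)) :
    RingHom.ker (param k T c) = std k T E := by
  classical
  apply le_antisymm
  · intro f hf
    rw [RingHom.mem_ker] at hf
    have h1 := sum_filter_mem_of_map_eq_zero (param k T c) (img c)
      (fun m => ∀ i, dg m i ≠ 0 → i ∈ T) (std k T E) (fun m hm => param_monomial T c m hm)
      (fun m hm => by
        push Not at hm
        obtain ⟨i, hi, hT⟩ := hm
        exact Or.inl (param_monomial_eq_zero T c m hi hT))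
      (fun m m' hm hm' h => by
        refine monomial_sub_mem_of_swaps c (std k T E) (dg m) ?_ _ m m' le_rfl rfl ?_ ?_
        · intro i j u hij hc hd
          have hpos : ∀ a, a = i ∨ a = j → a ∈ T := by
            intro a ha
            apply hm
            rw [← hd, dg_add, dg_add, dg_inl, dg_inr]
            rcases ha with rfl | rfl <;> simp
          have := Ideal.mul_mem_left _ (monomial u 1)
            (delta_mem_std_of_or (k := k) (T := T)
              ((hE i j (hpos i (Or.inl rfl)) (hpos j (Or.inr rfl)) hij).2 hc))
          convert this using 1
          rw [delta]; ring
        · funext i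
          rw [← img_inl c m', ← h, img_inl]
        · intro l
          have h1 := img_inr_inl c m l
          rw [h] at h1
          exact h1.symm.trans (img_inr_inl c m' l)) f hf
    rw [f.as_sum, ← Finset.sum_filter_add_sum_filter_not f.support
      (fun m => ∀ i, dg m i ≠ 0 → i ∈ T)]
    refine add_mem h1 (sum_mem fun m hm => ?_)
    have := (Finset.mem_filter.1 hm).2
    push Not at this
    obtain ⟨i, hi, hT⟩ := this
    exact monomial_mem_std m hi hT _
  · refine std_le_ker_param fun i j hi hj h => ?_
    by_cases hij : i = j
    · rw [hij]
    · exact (hE i j hi hj hij).1 (Or.inl h)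

theorem std_isPrime {T : Set (Fin n)} (c : Fin n → L) {E : Fin n → Fin n → Prop}
    (hE : ∀ i j, i ∈ T → j ∈ T → i ≠ j → (E i j ∨ E j i ↔ c i = c j)) :
    (std k T E).IsPrime := by
  rw [← ker_param hE]
  exact RingHom.ker_isPrime _

/-- The part of `f` in one multidegree lies in the edge ideal of `Γ` if `f` is in the kernel of a
parametrization whose classes are connected in `Γ` inside the support of the multidegree. -/
theorem sum_filter_dg_mem_edgeIdeal (Γ : SimpleGraph (Fin n)) (d : Fin n → ℕ) {T : Set (Fin n)}
    {c : Fin n → L} (hT : ∀ i, 0 < d i → i ∈ T)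
    (hc : ∀ i j, 0 < d i → 0 < d j → c i = c j →
      Relation.ReflTransGen (fun a b => Γ.Adj a b ∧ 0 < d a ∧ 0 < d b) i j)
    (f : PolyRing k n) (hf : param k T c f = 0) [DecidablePred fun m => dg (n := n) m = d] :
    ∑ m ∈ f.support with dg m = d, monomial m (coeff m f) ∈ edgeIdeal k Γ := by
  classical
  refine sum_filter_mem_of_map_eq_zero (param k T c) (img c) (fun m => dg m = d) _
    (fun m hm => param_monomial T c m fun i hi => hT i (by rw [← hm]; omega)) ?_ ?_ f hf
  · intro m hm
    by_cases h : ∀ i, dg m i ≠ 0 → i ∈ T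
    · refine Or.inr ⟨_, param_monomial T c m h, fun m' hm' he => hm ?_⟩
      rw [← hm']
      funext i
      rw [← img_inl c m', he, img_inl]
    · push Not at h
      obtain ⟨i, hi, h'⟩ := h
      exact Or.inl (param_monomial_eq_zero T c m hi h')
  · intro m m' hm hm' h
    refine monomial_sub_mem_of_swaps c _ d ?_ _ m m' le_rfl hm hm' fun l => by
      have h1 := img_inr_inl c m l
      rw [h] at h1
      exact h1.symm.trans (img_inr_inl c m' l)
    intro i j u hij hcij hd
    refine swap_mem_edgeIdeal Γ d (hc i j ?_ ?_ hcij) u hd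
    · rw [← hd, dg_add, dg_add, dg_inl, if_pos rfl]; omega
    · rw [← hd, dg_add, dg_add, dg_inr, if_pos rfl]; omega

end Param

/-! ### Associated primes of a finite irredundant intersection of primes -/

/-- The annihilator of the class of `f` is the intersection of those `p ∈ P` with `f ∉ p`. If it is
prime, it equals one of these finitely many `p`. Conversely, for `q ∈ P` the antichain condition
supplies an `f` that lies in all other members but not in `q`, and its annihilator is `q`. -/
theorem associatedPrimes_quotient_eq_of_eq_sInf {R : Type*} [CommRing R] [IsNoetherianRing R]
    (I : Ideal R) (P : Set (Ideal R)) (hfin : P.Finite) (hprime : ∀ p ∈ P, p.IsPrime)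
    (hanti : ∀ p ∈ P, ∀ q ∈ P, p ≤ q → p = q) (hI : ∀ f, f ∈ I ↔ ∀ p ∈ P, f ∈ p) :
    associatedPrimes R (R ⧸ I) = P := by
  classical
  have hcolon : ∀ f r : R, r ∈ (⊥ : Submodule R (R ⧸ I)).colon {Ideal.Quotient.mk I f} ↔
      ∀ p ∈ P, f ∈ p ∨ r ∈ p := by
    intro f r
    rw [Submodule.mem_colon_singleton, Submodule.mem_bot]
    have : r • Ideal.Quotient.mk I f = Ideal.Quotient.mk I (r * f) := rfl
    rw [this, Ideal.Quotient.eq_zero_iff_mem, hI]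
    refine forall₂_congr fun p hp => ?_
    rw [(hprime p hp).mul_mem_iff_mem_or_mem, or_comm]
  ext q
  rw [AssociatedPrimes.mem_iff, isAssociatedPrime_iff]
  constructor
  · rintro ⟨hq, z, hz⟩
    obtain ⟨f, rfl⟩ := Ideal.Quotient.mk_surjective z
    have hle : (hfin.toFinset.filter fun p => f ∉ p).inf id ≤ q := by
      intro r hr
      rw [hz, hcolon]
      intro p hp
      by_cases hf : f ∈ p
      · exact Or.inl hf
      · exact Or.inr (Finset.inf_le (f := id)
          (Finset.mem_filter.2 ⟨hfin.mem_toFinset.2 hp, hf⟩) hr)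
    obtain ⟨p, hp, hpq⟩ := hq.inf_le'.1 hle
    obtain ⟨hp, hf⟩ := Finset.mem_filter.1 hp
    have hqp : q ≤ p := by
      intro r hr
      rw [hz, hcolon] at hr
      exact (hr p (hfin.mem_toFinset.1 hp)).resolve_left hf
    rw [hqp.antisymm hpq]
    exact hfin.mem_toFinset.1 hp
  · intro hq
    refine ⟨hprime q hq, ?_⟩
    have hnot : ¬ (hfin.toFinset.erase q).inf id ≤ q := by
      intro hle
      obtain ⟨p, hp, hpq⟩ := (hprime q hq).inf_le'.1 hle
      obtain ⟨hne, hp⟩ := Finset.mem_erase.1 hp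
      exact hne (hanti p (hfin.mem_toFinset.1 hp) q hq hpq)
    obtain ⟨f, hf, hfq⟩ := SetLike.not_le_iff_exists.1 hnot
    refine ⟨Ideal.Quotient.mk I f, ?_⟩
    ext r
    rw [hcolon]
    constructor
    · intro hr p hp
      by_cases hpq : p = q
      · exact Or.inr (hpq ▸ hr)
      · exact Or.inl (Finset.inf_le (f := id)
          (Finset.mem_erase.2 ⟨hpq, hfin.mem_toFinset.2 hp⟩) hf)
    · intro h
      exact (h q hq).resolve_left hfq

/-! ### Graphs of girth at least five -/

section Graph

variable {n : ℕ} {G : SimpleGraph (Fin n)}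

theorem not_triangle_of_girth (hG : 5 ≤ G.egirth) {a b c : Fin n} (hab : G.Adj a b)
    (hbc : G.Adj b c) (hac : G.Adj a c) : False := by
  have hcyc : (SimpleGraph.Walk.cons hab (.cons hbc (.cons hac.symm .nil))).IsCycle := by
    simp [SimpleGraph.Walk.cons_isCycle_iff, SimpleGraph.Walk.cons_isPath_iff, hab.ne', hac.ne,
      hac.ne', hbc.ne, hab.ne]
  have := (SimpleGraph.le_egirth.1 hG) _ _ hcyc
  simp only [SimpleGraph.Walk.length_cons, SimpleGraph.Walk.length_nil] at this
  exact absurd this (by norm_cast)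

theorem not_square_of_girth (hG : 5 ≤ G.egirth) {a b c d : Fin n} (hab : G.Adj a b)
    (hbc : G.Adj b c) (hcd : G.Adj c d) (hda : G.Adj d a) (hac : a ≠ c) (hbd : b ≠ d) :
    False := by
  have hcyc : (SimpleGraph.Walk.cons hab (.cons hbc (.cons hcd (.cons hda .nil)))).IsCycle := by
    simp [SimpleGraph.Walk.cons_isCycle_iff, SimpleGraph.Walk.cons_isPath_iff, hab.ne', hac.symm,
      hac, hbc.ne, hab.ne, hbd, hcd.ne, hda.ne, hda.ne']
  have := (SimpleGraph.le_egirth.1 hG) _ _ hcyc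
  simp only [SimpleGraph.Walk.length_cons, SimpleGraph.Walk.length_nil] at this
  exact absurd this (by norm_cast)

/-- Core membership means degree at least 2 in `G`, not in the core: leaves are removed once, so the
core may itself have leaves and isolated vertices. -/
theorem mem_core_iff {v : Fin n} :
    v ∈ (core G).verts ↔ ∃ a b, a ≠ b ∧ G.Adj v a ∧ G.Adj v b := by
  have h1 : v ∈ (core G).verts ↔ 1 < (G.neighborSet v).ncard := by
    simp only [core, SimpleGraph.Subgraph.deleteVerts_verts, SimpleGraph.Subgraph.verts_top,
      Set.mem_sdiff, Set.mem_univ, true_and, Set.mem_ofPred_eq]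
    omega
  rw [h1, Set.one_lt_ncard]
  simp only [SimpleGraph.mem_neighborSet]
  constructor
  · rintro ⟨a, ha, b, hb, hab⟩
    exact ⟨a, b, hab, ha, hb⟩
  · rintro ⟨a, b, hab, ha, hb⟩
    exact ⟨a, ha, b, hb, hab⟩

theorem core_adj_iff {v w : Fin n} :
    (core G).Adj v w ↔ G.Adj v w ∧ v ∈ (core G).verts ∧ w ∈ (core G).verts := by
  simp only [core, SimpleGraph.Subgraph.deleteVerts_verts, SimpleGraph.Subgraph.verts_top,
      Set.mem_sdiff, Set.mem_univ, true_and, SimpleGraph.Subgraph.deleteVerts_adj,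
      SimpleGraph.Subgraph.top_adj]
  tauto

theorem one_lt_core_ncard_iff {v : Fin n} : 1 < ((core G).neighborSet v).ncard ↔
    ∃ a b, a ≠ b ∧ (core G).Adj v a ∧ (core G).Adj v b := by
  rw [Set.one_lt_ncard]
  simp only [SimpleGraph.Subgraph.mem_neighborSet]
  constructor
  · rintro ⟨a, ha, b, hb, hab⟩
    exact ⟨a, b, hab, ha, hb⟩
  · rintro ⟨a, b, hab, ha, hb⟩
    exact ⟨a, ha, b, hb, hab⟩

theorem mem_freeEdges_iff {v w : Fin n} : s(v, w) ∈ freeEdges G ↔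
    G.Adj v w ∧ (∀ u, G.Adj v u → u = w) ∧ ∀ u, G.Adj w u → u = v := by
  rw [freeEdges, Set.mem_ofPred_eq, SimpleGraph.mem_edgeSet]
  refine and_congr_right fun hvw => ?_
  constructor
  · rintro ⟨C, hC⟩
    have hv : v ∈ C.supp := by rw [hC]; simp
    have hw : w ∈ C.supp := by rw [hC]; simp
    have key : ∀ a u, a ∈ C.supp → G.Adj a u → u = v ∨ u = w := by
      intro a u ha hau
      have hu : u ∈ C.supp := (C.mem_supp_congr_adj hau).1 ha
      rw [hC] at hu
      simpa using hu
    exact ⟨fun u hu => (key v u hv hu).resolve_left hu.ne',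
      fun u hu => (key w u hw hu).resolve_right hu.ne'⟩
  · rintro ⟨h1, h2⟩
    refine ⟨G.connectedComponentMk v, ?_⟩
    ext u
    rw [SimpleGraph.ConnectedComponent.mem_supp_iff, SimpleGraph.ConnectedComponent.eq]
    have hu : u ∈ ((s(v, w) : Sym2 (Fin n)) : Set (Fin n)) ↔ u = v ∨ u = w := by simp
    rw [hu]
    constructor
    · rintro ⟨p⟩
      have : ∀ {a b : Fin n} (_ : G.Walk a b), b = v ∨ b = w → a = v ∨ a = w := by
        intro a b p hb
        induction p with
        | nil => exact hb
        | cons h _ ih =>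
          rcases ih hb with rfl | rfl
          · exact Or.inr (h1 _ h.symm)
          · exact Or.inl (h2 _ h.symm)
      exact this p (Or.inl rfl)
    · rintro (rfl | rfl)
      · exact SimpleGraph.Reachable.refl _
      · exact hvw.symm.reachable

theorem ne_of_mem_core_of_mem_freeEdges {u v w : Fin n} (hu : u ∈ (core G).verts)
    (hvw : s(v, w) ∈ freeEdges G) : u ≠ v ∧ u ≠ w := by
  rw [mem_freeEdges_iff] at hvw
  obtain ⟨a, b, hab, ha, hb⟩ := mem_core_iff.1 hu
  constructor
  · rintro rfl
    exact hab ((hvw.2.1 a ha).trans (hvw.2.1 b hb).symm)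
  · rintro rfl
    exact hab ((hvw.2.2 a ha).trans (hvw.2.2 b hb).symm)

theorem exists_center_of_isStar (h : IsStar (core G)) :
    ∃ c ∈ (core G).verts, ∀ v ∈ (core G).verts, v = c ∨ G.Adj c v := by
  obtain ⟨c, hc⟩ := h
  refine ⟨c, c.2, fun v hv => ?_⟩
  by_cases hvc : v = c
  · exact Or.inl hvc
  · right
    have : (core G).coe.Adj c ⟨v, hv⟩ := by
      rw [hc, SimpleGraph.starGraph_adj]
      exact ⟨fun h => hvc (congrArg Subtype.val h).symm, Or.inl rfl⟩
    exact (core_adj_iff.1 this).1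

theorem isStar_of_center (hG : 5 ≤ G.egirth) {c : Fin n} (hc : c ∈ (core G).verts)
    (h : ∀ v ∈ (core G).verts, v = c ∨ G.Adj c v) : IsStar (core G) := by
  refine ⟨⟨c, hc⟩, ?_⟩
  ext ⟨a, ha⟩ ⟨b, hb⟩
  rw [SimpleGraph.starGraph_adj, SimpleGraph.Subgraph.coe_adj, core_adj_iff]
  simp only [ne_eq, Subtype.mk.injEq]
  constructor
  · rintro ⟨hab, -, -⟩
    refine ⟨hab.ne, ?_⟩
    by_contra! hcon
    exact not_triangle_of_girth hG ((h a ha).resolve_left hcon.1) hab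
      ((h b hb).resolve_left hcon.2)
  · rintro ⟨hab, rfl | rfl⟩
    · exact ⟨(h b hb).resolve_left (Ne.symm hab), ha, hb⟩
    · exact ⟨((h a ha).resolve_left hab).symm, ha, hb⟩

/-- A set of vertices is connected in the complement of `G`, or some vertex is joined to all the
others in `G`. -/
theorem compl_connected_or_star (hG : 5 ≤ G.egirth) (T : Set (Fin n)) :
    (∀ i j, i ∈ T → j ∈ T → Relation.ReflTransGen (fun a b => Gᶜ.Adj a b ∧ a ∈ T ∧ b ∈ T) i j) ∨
      ∃ v ∈ T, ∃ w ∈ T, w ≠ v ∧ ∀ u ∈ T, u ≠ v → G.Adj v u := by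
  by_contra! hcon
  obtain ⟨⟨i, j, hi, hj, hij⟩, h⟩ := hcon
  have hne : j ≠ i := by rintro rfl; exact hij .refl
  have hadj : ∀ a b, a ∈ T → b ∈ T →
      Relation.ReflTransGen (fun a b => Gᶜ.Adj a b ∧ a ∈ T ∧ b ∈ T) i a →
      ¬ Relation.ReflTransGen (fun a b => Gᶜ.Adj a b ∧ a ∈ T ∧ b ∈ T) i b → G.Adj a b := by
    intro a b ha hb hia hib
    by_contra hab
    have hab' : a ≠ b := by rintro rfl; exact hib hia
    exact hib (hia.tail ⟨(G.compl_adj a b).2 ⟨hab', hab⟩, ha, hb⟩)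
  -- Vertices in different components of `Gᶜ` on `T` are adjacent in `G`. A non-neighbour `a ≠ i` of
  -- `i` lies on the side of `i`, a non-neighbour `b ≠ j` of `j` on the other side, so `i, j, a, b`
  -- is a 4-cycle.
  obtain ⟨a, ha, hai, hia⟩ := h i hi j hj hne
  have hra : Relation.ReflTransGen (fun a b => Gᶜ.Adj a b ∧ a ∈ T ∧ b ∈ T) i a := by
    by_contra hra
    exact hia (hadj i a hi ha .refl hra)
  obtain ⟨b, hb, hbj, hjb⟩ := h j hj i hi hne.symm
  have hrb : ¬ Relation.ReflTransGen (fun a b => Gᶜ.Adj a b ∧ a ∈ T ∧ b ∈ T) i b := by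
    intro hrb
    exact hjb (hadj b j hb hj hrb hij).symm
  exact not_square_of_girth hG (hadj i j hi hj .refl hij) (hadj a j ha hj hra hij).symm
    (hadj a b ha hb hra hrb) (hadj i b hi hb .refl hrb).symm hai.symm hbj.symm

end Graph

/-! ### The named ideals in the form `std k T E`, their primality, and the primary decomposition of
`J(Gᶜ)` -/

section Bridge

variable (k : Type*) [Field k] {n : ℕ} (G : SimpleGraph (Fin n))

theorem mem_closedNbr {v i : Fin n} : i ∈ closedNbr G v ↔ i = v ∨ G.Adj v i := Iff.rfl

theorem varIdeal_eq_std (S : Set (Fin n)) : varIdeal k Sᶜ = std k S fun _ _ => False := by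
  simp [std]

theorem varIdeal_add_edgeIdeal (S : Set (Fin n)) (Γ : SimpleGraph (Fin n)) :
    varIdeal k Sᶜ + edgeIdeal k Γ = std k S Γ.Adj := by
  rw [varIdeal_eq_std, edgeIdeal_eq_std, Submodule.add_eq_sup, std_sup_std]
  simp

theorem jI_eq_std : jI k n = std k Set.univ fun _ _ => True := by
  rw [jI, edgeIdeal_eq_std, std_eq_std_iff]
  exact ⟨rfl, fun i j _ _ _ _ => Or.inl trivial, fun i j _ h _ _ => Or.inl h⟩

theorem aI_eq_std (v : Fin n) :
    aI k G v = std k (closedNbr G v) fun i j => G.Adj v i ∧ G.Adj v j := by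
  rw [aI, varIdeal_add_edgeIdeal, std_eq_std_iff]
  simp only [completeOn, SimpleGraph.fromRel_adj, SimpleGraph.mem_neighborSet]
  refine ⟨trivial, ?_, ?_⟩ <;> intros <;> tauto

theorem bI_eq_std (v : Fin n) : bI k G v = std k (closedNbr G v) fun _ _ => True := by
  rw [bI, varIdeal_add_edgeIdeal, std_eq_std_iff]
  simp only [completeOn, SimpleGraph.fromRel_adj]
  refine ⟨trivial, ?_, ?_⟩ <;> intros <;> tauto

theorem aI'_eq_std (v w : Fin n) : aI' k v w = std k {v, w} fun _ _ => False :=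
  varIdeal_eq_std k _

theorem cI_eq_std (v w : Fin n) : cI k v w = std k {v, w} fun _ _ => False :=
  varIdeal_eq_std k _

/-- On a one-element support the relation is immaterial; the full relation makes the absorption of 𝔧
immediate. -/
theorem eI_eq_std (v : Fin n) : eI k v = std k {v} fun _ _ => True := by
  rw [eI, varIdeal_eq_std, std_eq_std_iff]
  refine ⟨rfl, fun _ _ h => h.elim, fun i j _ hij hi hj => (hij ?_).elim⟩
  rw [Set.mem_singleton_iff] at hi hj
  rw [hi, hj]

theorem dI_eq_std (v w : Fin n) : dI k v w = std k {v, w} fun _ _ => True := by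
  have h : (Ideal.span {delta k v w} : Ideal (PolyRing k n)) =
      Ideal.span {f | ∃ i j, (i = v ∧ j = w) ∧ f = delta k i j} := by
    congr 1
    ext f
    simp only [Set.mem_singleton_iff, Set.mem_ofPred_eq]
    constructor
    · rintro rfl
      exact ⟨v, w, ⟨rfl, rfl⟩, rfl⟩
    · rintro ⟨i, j, ⟨rfl, rfl⟩, rfl⟩
      rfl
  rw [dI, h, Submodule.add_eq_sup]
  change std k {v, w} (fun i j => i = v ∧ j = w) = _
  rw [std_eq_std_iff]
  refine ⟨rfl, fun _ _ _ _ _ _ => Or.inl trivial, fun i j _ hij hi hj => ?_⟩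
  rw [Set.mem_insert_iff, Set.mem_singleton_iff] at hi hj
  rcases hi with rfl | rfl <;> rcases hj with rfl | rfl
  · exact (hij rfl).elim
  · exact Or.inl ⟨rfl, rfl⟩
  · exact Or.inr ⟨rfl, rfl⟩
  · exact (hij rfl).elim

theorem bI'_eq_std (v w : Fin n) : bI' k v w = std k {v, w} fun _ _ => True :=
  dI_eq_std k v w

theorem mI_eq_std : mI k n = std k ∅ fun _ _ => True := by
  apply le_antisymm
  · rw [mI, Ideal.span_le]
    rintro _ ⟨i | i, rfl⟩
    · exact x_mem_std (Set.notMem_empty i)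
    · exact y_mem_std (Set.notMem_empty i)
  · have hx : ∀ i, x k i ∈ mI k n := fun i => Ideal.subset_span ⟨Sum.inl i, rfl⟩
    have hy : ∀ i, y k i ∈ mI k n := fun i => Ideal.subset_span ⟨Sum.inr i, rfl⟩
    rw [std_le_iff_forall]
    exact ⟨fun i _ => ⟨hx i, hy i⟩, fun i j _ =>
      sub_mem (Ideal.mul_mem_left _ _ (hy j)) (Ideal.mul_mem_left _ _ (hy i))⟩

/-! ### Primality -/

theorem std_true_isPrime (T : Set (Fin n)) : (std k T fun _ _ => True).IsPrime :=
  std_isPrime (fun _ => ()) fun i j _ _ _ => by simp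

theorem std_false_isPrime (T : Set (Fin n)) : (std k T fun _ _ => False).IsPrime :=
  std_isPrime id fun i j _ _ hij => by simpa using hij

/-- The relation of 𝔞_v splits `N[v]` into the two classes `{v}` and `N(v)`; the proposition `i = v`
serves as the class label. -/
theorem adj_iff_of_mem_closedNbr {v i j : Fin n} (hi : i ∈ closedNbr G v)
    (hj : j ∈ closedNbr G v) (hij : i ≠ j) :
    ((G.Adj v i ∧ G.Adj v j) ∨ (G.Adj v j ∧ G.Adj v i) ↔ (i = v) = (j = v)) := by
  rw [mem_closedNbr] at hi hj
  have : ¬ G.Adj v v := G.loopless.irrefl v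
  rw [eq_iff_iff]
  constructor
  · grind
  · intro h
    grind

theorem aI_isPrime (v : Fin n) : (aI k G v).IsPrime := by
  rw [aI_eq_std]
  exact std_isPrime (fun i => i = v) fun i j hi hj hij => adj_iff_of_mem_closedNbr G hi hj hij

theorem isPrime_of_pIdeal {I : Ideal (PolyRing k n)} (h : PIdeal k G I) : I.IsPrime := by
  cases h with
  | j => rw [jI_eq_std]; exact std_true_isPrime k _
  | a v hv => exact aI_isPrime k G v
  | a' v w h => rw [aI'_eq_std]; exact std_false_isPrime k _
  | b v hv => rw [bI_eq_std]; exact std_true_isPrime k _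
  | b' v w h => rw [bI'_eq_std]; exact std_true_isPrime k _
  | c v w h => rw [cI_eq_std]; exact std_false_isPrime k _
  | d v w h => rw [dI_eq_std]; exact std_true_isPrime k _
  | e v hv h => rw [eI_eq_std]; exact std_true_isPrime k _
  | m h => rw [mI_eq_std]; exact std_true_isPrime k _

/-! ### The minimal primes of `J(Gᶜ)` -/

/-- The minimal primes of `J(Gᶜ)`. -/
inductive MinIdeal : Ideal (PolyRing k n) → Prop
  | j : MinIdeal (jI k n)
  | a (v : Fin n) (hv : v ∈ (core G).verts) : MinIdeal (aI k G v)
  | a' (v w : Fin n) (h : s(v, w) ∈ freeEdges G) : MinIdeal (aI' k v w)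

variable {k G}

theorem MinIdeal.pIdeal {I : Ideal (PolyRing k n)} (h : MinIdeal k G I) : PIdeal k G I := by
  cases h with
  | j => exact .j
  | a v hv => exact .a v hv
  | a' v w h => exact .a' v w h

theorem finite_minIdeal : {I | MinIdeal k G I}.Finite := by
  refine Set.Finite.subset (((Set.finite_singleton (jI k n)).union
    (Set.finite_range (aI k G))).union
    (Set.finite_range fun p : Fin n × Fin n => aI' k p.1 p.2)) ?_
  rintro I hI
  cases hI with
  | j => exact Or.inl (Or.inl rfl)
  | a v hv => exact Or.inl (Or.inr ⟨v, rfl⟩)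
  | a' v w h => exact Or.inr ⟨(v, w), rfl⟩

theorem edgeIdeal_compl_le {I : Ideal (PolyRing k n)} (h : MinIdeal k G I) :
    edgeIdeal k Gᶜ ≤ I := by
  rw [edgeIdeal_eq_std]
  cases h with
  | j =>
    rw [jI_eq_std, std_le_std_iff]
    exact ⟨subset_rfl, fun _ _ _ _ _ _ => Or.inl trivial⟩
  | a v hv =>
    rw [aI_eq_std, std_le_std_iff]
    refine ⟨Set.subset_univ _, fun i j hij hne hi hj => ?_⟩
    rw [mem_closedNbr] at hi hj
    rw [SimpleGraph.compl_adj] at hij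
    rcases hi with rfl | hi
    · rcases hj with rfl | hj
      · exact (hne rfl).elim
      · exact (hij.2 hj).elim
    · rcases hj with rfl | hj
      · exact (hij.2 hi.symm).elim
      · exact Or.inl ⟨hi, hj⟩
  | a' v w h =>
    rw [aI'_eq_std, std_le_std_iff]
    refine ⟨Set.subset_univ _, fun i j hij hne hi hj => ?_⟩
    rw [SimpleGraph.compl_adj] at hij
    rw [mem_freeEdges_iff] at h
    rw [Set.mem_insert_iff, Set.mem_singleton_iff] at hi hj
    rcases hi with rfl | rfl <;> rcases hj with rfl | rfl
    · exact (hne rfl).elim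
    · exact (hij.2 h.1).elim
    · exact (hij.2 h.1.symm).elim
    · exact (hne rfl).elim

theorem param_eq_zero_of_mem {L : Type*} {T : Set (Fin n)} {E : Fin n → Fin n → Prop}
    {f : PolyRing k n} (hf : f ∈ std k T E) (c : Fin n → L)
    (hE : ∀ i j, i ∈ T → j ∈ T → E i j → c i = c j) : param k T c f = 0 :=
  std_le_ker_param hE hf

theorem mem_edgeIdeal_compl (hG : 5 ≤ G.egirth) {f : PolyRing k n}
    (hf : ∀ I, MinIdeal k G I → f ∈ I) : f ∈ edgeIdeal k Gᶜ := by
  classical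
  -- Membership is checked one multidegree `d` at a time; the relevant graph is the one induced on
  -- the vertices with `0 < d i`.
  rw [f.as_sum, ← Finset.sum_fiberwise_of_maps_to
    (fun m hm => Finset.mem_image_of_mem (dg (n := n)) hm)]
  refine sum_mem fun d _ => ?_
  -- The star case with centre in the core: two vertices of the support other than `v` are not
  -- adjacent in `G`, for lack of triangles, so the classes of 𝔞_v are connected in `Gᶜ` by single
  -- edges.
  have hf_star : ∀ v w, v ∈ (core G).verts → 0 < d v → 0 < d w → w ≠ v →
      (∀ u, 0 < d u → u ≠ v → G.Adj v u) →
      ∑ m ∈ f.support with dg m = d, monomial m (coeff m f) ∈ edgeIdeal k Gᶜ := by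
    intro v w hv hdv hdw hwv hu
    have h0 := hf _ (.a v hv)
    rw [aI_eq_std] at h0
    refine sum_filter_dg_mem_edgeIdeal Gᶜ d (T := closedNbr G v) (c := fun i => i = v) ?_ ?_ f
      (param_eq_zero_of_mem h0 _ fun i j hi hj h => ?_)
    · intro i hi
      rw [mem_closedNbr, or_iff_not_imp_left]
      exact hu i hi
    · intro i j hi hj hij
      by_cases hne : i = j
      · rw [hne]
      have hiv : i ≠ v := fun h => hne (h.trans (hij.mp h).symm)
      have hjv : j ≠ v := fun h => hiv (hij.mpr h)
      refine Relation.ReflTransGen.single ⟨(G.compl_adj i j).2 ⟨hne, fun hadj => ?_⟩, hi, hj⟩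
      exact not_triangle_of_girth hG (hu i hi hiv) hadj (hu j hj hjv)
    · by_cases hij : i = j
      · rw [hij]
      · exact (adj_iff_of_mem_closedNbr G hi hj hij).1 (Or.inl h)
  rcases compl_connected_or_star hG {i | 0 < d i} with h | ⟨v, hv, w, hw, hwv, hu⟩
  · have h0 := hf _ .j
    rw [jI_eq_std] at h0
    exact sum_filter_dg_mem_edgeIdeal Gᶜ d (T := Set.univ) (c := fun _ => ())
      (fun i _ => Set.mem_univ i) (fun i j hi hj _ => h i j hi hj) f
      (param_eq_zero_of_mem h0 _ fun _ _ _ _ _ => rfl)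
  · by_cases hcv : v ∈ (core G).verts
    · exact hf_star v w hcv hv hw hwv hu
    have hvw : G.Adj v w := hu w hw hwv
    -- A centre outside the core has `w` as its only neighbour, so the support is `{v, w}`. Then `w`
    -- is a centre as well, and if it too is outside the core, `{v, w}` is a free edge.
    have hNv : ∀ u, G.Adj v u → u = w := by
      intro u huv
      by_contra huw
      exact hcv (mem_core_iff.2 ⟨u, w, huw, huv, hvw⟩)
    by_cases hcw : w ∈ (core G).verts
    · refine hf_star w v hcw hw hv hwv.symm fun u hdu huw => ?_
      by_cases huv : u = v
      · rw [huv]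
        exact hvw.symm
      · exact (huw (hNv u (hu u hdu huv))).elim
    have hNw : ∀ u, G.Adj w u → u = v := by
      intro u huw
      by_contra huv
      exact hcw (mem_core_iff.2 ⟨u, v, huv, huw, hvw.symm⟩)
    have h0 := hf _ (.a' v w (mem_freeEdges_iff.2 ⟨hvw, hNv, hNw⟩))
    rw [aI'_eq_std] at h0
    refine sum_filter_dg_mem_edgeIdeal Gᶜ d (T := {v, w}) (c := id) ?_ ?_ f
      (param_eq_zero_of_mem h0 _ fun _ _ _ _ h => h.elim)
    · intro i hi
      rw [Set.mem_insert_iff, Set.mem_singleton_iff, or_iff_not_imp_left]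
      exact fun hiv => hNv i (hu i hi hiv)
    · intro i j _ _ hij
      rw [show i = j from hij]

/-- 𝔧 lies in no other prime since it contains the binomials of edges of `G`, and no other prime
lies in 𝔧 since a support equal to all vertices would give a universal vertex. Among the rest
supports decide: `N[u] ⊆ N[v]` with `u ≠ v` would put the second neighbour of `u` into a triangle.
-/
theorem minIdeal_antichain (hG : 5 ≤ G.egirth) (huniv : ∀ v, ¬ G.IsUniversal v)
    {I I' : Ideal (PolyRing k n)} (h : MinIdeal k G I) (h' : MinIdeal k G I') (hle : I ≤ I') :
    I = I' := by
  cases h with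
  | j =>
    cases h' with
    | j => rfl
    | a v hv =>
      rw [jI_eq_std, aI_eq_std, std_le_std_iff] at hle
      obtain ⟨a, b, hab, ha, hb⟩ := mem_core_iff.1 hv
      have := hle.2 v a trivial ha.ne (Or.inl rfl) (Or.inr ha)
      simp at this
    | a' v w h =>
      rw [jI_eq_std, aI'_eq_std, std_le_std_iff] at hle
      have := hle.2 v w trivial (mem_freeEdges_iff.1 h).1.ne (by simp) (by simp)
      simp at this
  | a v hv =>
    cases h' with
    | j =>
      rw [jI_eq_std, aI_eq_std, std_le_std_iff] at hle
      refine (huniv v fun w hvw => ?_).elim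
      exact (hle.1 (Set.mem_univ w)).resolve_left hvw.symm
    | a u hu =>
      rw [aI_eq_std, aI_eq_std, std_le_std_iff] at hle
      rcases hle.1 (Or.inl rfl : u ∈ closedNbr G u) with rfl | huv
      · rfl
      obtain ⟨a, b, hab, ha, hb⟩ := mem_core_iff.1 hu
      have key : ∀ c, G.Adj u c → c = v := fun c hc =>
        (hle.1 (Or.inr hc : c ∈ closedNbr G u)).resolve_right fun h =>
          not_triangle_of_girth hG huv hc h
      exact (hab ((key a ha).trans (key b hb).symm)).elim
    | a' u w h =>
      rw [aI_eq_std, aI'_eq_std, std_le_std_iff] at hle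
      have h1 := hle.1 (by simp : u ∈ ({u, w} : Set (Fin n)))
      rw [mem_closedNbr] at h1
      have h2 := ne_of_mem_core_of_mem_freeEdges hv h
      rw [mem_freeEdges_iff] at h
      exact (h1.elim (fun e => h2.1 e.symm) fun e => h2.2 (h.2.1 v e.symm)).elim
  | a' v w h =>
    cases h' with
    | j =>
      rw [jI_eq_std, aI'_eq_std, std_le_std_iff] at hle
      refine (huniv v fun u hvu => ?_).elim
      have := (hle.1 (Set.mem_univ u))
      rw [Set.mem_insert_iff, Set.mem_singleton_iff] at this
      rw [this.resolve_left hvu.symm]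
      exact (mem_freeEdges_iff.1 h).1
    | a u hu =>
      rw [aI_eq_std, aI'_eq_std, std_le_std_iff] at hle
      have h1 := hle.1 (Or.inl rfl : u ∈ closedNbr G u)
      rw [Set.mem_insert_iff, Set.mem_singleton_iff] at h1
      have h2 := ne_of_mem_core_of_mem_freeEdges hu h
      exact (h1.elim h2.1 h2.2).elim
    | a' a b h' =>
      rw [aI'_eq_std, aI'_eq_std, std_le_std_iff] at hle
      have ha := hle.1 (by simp : a ∈ ({a, b} : Set (Fin n)))
      have hb := hle.1 (by simp : b ∈ ({a, b} : Set (Fin n)))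
      have hab := (mem_freeEdges_iff.1 h').1.ne
      rw [Set.mem_insert_iff, Set.mem_singleton_iff] at ha hb
      rcases ha with rfl | rfl <;> rcases hb with rfl | rfl
      · exact (hab rfl).elim
      · rfl
      · rw [aI', aI', Set.pair_comm]
      · exact (hab rfl).elim

theorem associatedPrimes_edgeIdeal_compl (hG : 5 ≤ G.egirth) (huniv : ∀ v, ¬ G.IsUniversal v) :
    associatedPrimes (PolyRing k n) (PolyRing k n ⧸ edgeIdeal k Gᶜ) = {I | MinIdeal k G I} :=
  associatedPrimes_quotient_eq_of_eq_sInf _ _ finite_minIdeal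
    (fun _ h => isPrime_of_pIdeal k G h.pIdeal)
    (fun _ h _ h' hle => minIdeal_antichain hG huniv h h' hle)
    fun _ => ⟨fun hf _ h => edgeIdeal_compl_le h hf, fun hf => mem_edgeIdeal_compl hG hf⟩

end Bridge

section Sums

variable {k : Type*} [Field k] {n : ℕ} {G : SimpleGraph (Fin n)}

/-! ### When `𝔪` belongs to the poset -/

theorem hasM_of_freeEdges_of_core {u v w : Fin n} (hu : u ∈ (core G).verts)
    (h : s(v, w) ∈ freeEdges G) : HasM G :=
  Or.inr ⟨⟨u, hu⟩, Or.inl ⟨_, h⟩⟩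

theorem hasM_of_freeEdges_ne {e e' : Sym2 (Fin n)} (h : e ∈ freeEdges G) (h' : e' ∈ freeEdges G)
    (hne : e ≠ e') : HasM G :=
  Or.inl ((Set.one_lt_ncard).2 ⟨e, h, e', h', hne⟩)

theorem hasM_of_no_center {u : Fin n} (hu : u ∈ (core G).verts)
    (h : ∀ c ∈ (core G).verts, ¬ ∀ v ∈ (core G).verts, v = c ∨ G.Adj c v) : HasM G := by
  refine Or.inr ⟨⟨u, hu⟩, Or.inr fun hstar => ?_⟩
  obtain ⟨c, hc, hcv⟩ := exists_center_of_isStar hstar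
  exact h c hc hcv

/-! ### Sums of the ideals -/

theorem std_eq_mI {T : Set (Fin n)} {E : Fin n → Fin n → Prop} (h : ∀ i, i ∉ T) :
    std k T E = mI k n := by
  rw [mI_eq_std, std_eq_std_iff]
  exact ⟨Set.eq_empty_of_forall_notMem h, fun i _ _ _ hi => (h i hi).elim,
    fun i _ _ _ hi => (h i hi).elim⟩

theorem std_eq_eI {T : Set (Fin n)} {E : Fin n → Fin n → Prop} {v : Fin n}
    (h : ∀ i, i ∈ T ↔ i = v) : std k T E = eI k v := by
  rw [eI_eq_std, std_eq_std_iff]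
  exact ⟨Set.ext h, fun i j _ hij hi hj => (hij (((h i).1 hi).trans ((h j).1 hj).symm)).elim,
    fun i j _ hij hi hj => (hij (((h i).1 hi).trans ((h j).1 hj).symm)).elim⟩

/-- Adding 𝔧 keeps the support and makes the relation full, which produces 𝔟, 𝔟', 𝔡 from 𝔞, 𝔞', 𝔠
and fixes 𝔢 and 𝔪. -/
theorem std_sup_jI (T : Set (Fin n)) (E : Fin n → Fin n → Prop) :
    std k T E ⊔ jI k n = std k T fun _ _ => True := by
  rw [jI_eq_std, std_sup_std, Set.inter_univ]
  simp

theorem aI_sup_jI (v : Fin n) : aI k G v ⊔ jI k n = bI k G v := by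
  rw [aI_eq_std, std_sup_jI, bI_eq_std]

theorem aI'_sup_jI (v w : Fin n) : aI' k v w ⊔ jI k n = bI' k v w := by
  rw [aI'_eq_std, std_sup_jI, bI'_eq_std]

theorem cI_sup_jI (v w : Fin n) : cI k v w ⊔ jI k n = dI k v w := by
  rw [cI_eq_std, std_sup_jI, dI_eq_std]

theorem eI_sup_jI (v : Fin n) : eI k v ⊔ jI k n = eI k v := by
  rw [eI_eq_std, std_sup_jI]

theorem mI_sup_jI : mI k n ⊔ jI k n = mI k n := by
  rw [mI_eq_std, std_sup_jI]

theorem mI_sup_std (T : Set (Fin n)) (E : Fin n → Fin n → Prop) :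
    mI k n ⊔ std k T E = mI k n := by
  rw [mI_eq_std, std_sup_std, std_eq_mI, mI_eq_std]
  exact fun i hi => hi.1

theorem pair_eq_of_adj {v w a b : Fin n} (hvw : v ≠ w)
    (h : ({v, w} : Set (Fin n)) ⊆ {a, b}) : (v = a ∧ w = b) ∨ (v = b ∧ w = a) := by
  have hv := h (by simp : v ∈ ({v, w} : Set (Fin n)))
  have hw := h (by simp : w ∈ ({v, w} : Set (Fin n)))
  rw [Set.mem_insert_iff, Set.mem_singleton_iff] at hv hw
  grind

/-- Without triangles `N[v] ∩ N[w] = {v, w}`, and no binomial survives there, as those of 𝔞_v avoid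
`v` and those of 𝔞_w avoid `w`. -/
theorem aI_sup_aI_of_adj (hG : 5 ≤ G.egirth) {v w : Fin n} (h : G.Adj v w) :
    aI k G v ⊔ aI k G w = cI k v w := by
  rw [aI_eq_std, aI_eq_std, cI_eq_std, std_sup_std, std_eq_std_iff]
  have hT : closedNbr G v ∩ closedNbr G w = {v, w} := by
    ext i
    rw [Set.mem_inter_iff, mem_closedNbr, mem_closedNbr, Set.mem_insert_iff,
      Set.mem_singleton_iff]
    constructor
    · rintro ⟨rfl | h1, rfl | h2⟩
      · exact Or.inl rfl
      · exact Or.inl rfl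
      · exact Or.inr rfl
      · exact (not_triangle_of_girth hG h h2 h1).elim
    · rintro (rfl | rfl)
      · exact ⟨Or.inl rfl, Or.inr h.symm⟩
      · exact ⟨Or.inr h, Or.inl rfl⟩
  refine ⟨hT, fun i j hij hne hi hj => ?_, fun _ _ h => h.elim⟩
  rw [hT, Set.mem_insert_iff, Set.mem_singleton_iff] at hi hj
  have h1 : ¬ G.Adj v v := G.loopless.irrefl v
  have h2 : ¬ G.Adj w w := G.loopless.irrefl w
  grind

/-- Here `N[u] ∩ N[v] = {w}`: `u` and `v` are not adjacent, for lack of triangles, and a second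
common neighbour would close a 4-cycle. -/
theorem aI_sup_aI_of_common (hG : 5 ≤ G.egirth) {u v w : Fin n} (huv : u ≠ v) (hu : G.Adj w u)
    (hv : G.Adj w v) : aI k G u ⊔ aI k G v = eI k w := by
  rw [aI_eq_std, aI_eq_std, std_sup_std]
  apply std_eq_eI
  intro i
  rw [Set.mem_inter_iff, mem_closedNbr, mem_closedNbr]
  constructor
  · rintro ⟨rfl | h1, rfl | h2⟩
    · exact (huv rfl).elim
    · exact (not_triangle_of_girth hG hv h2 hu).elim
    · exact (not_triangle_of_girth hG hu h1 hv).elim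
    · by_contra hiw
      exact not_square_of_girth hG hu h1 h2.symm hv.symm (Ne.symm hiw) huv
  · rintro rfl
    exact ⟨Or.inr hu.symm, Or.inr hv.symm⟩

/-- The ideals of the poset other than those obtained by adding `𝔧`. -/
inductive PreIdeal (G : SimpleGraph (Fin n)) : Ideal (PolyRing k n) → Prop
  | a (v : Fin n) (hv : v ∈ (core G).verts) : PreIdeal G (aI k G v)
  | a' (v w : Fin n) (h : s(v, w) ∈ freeEdges G) : PreIdeal G (aI' k v w)
  | c (v w : Fin n) (h : (core G).Adj v w) : PreIdeal G (cI k v w)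
  | e (v : Fin n) (hv : v ∈ (core G).verts) (h : 1 < ((core G).neighborSet v).ncard) :
      PreIdeal G (eI k v)
  | m (h : HasM G) : PreIdeal G (mI k n)

theorem PreIdeal.pIdeal {I : Ideal (PolyRing k n)} (h : PreIdeal G I) : PIdeal k G I := by
  cases h with
  | a v hv => exact .a v hv
  | a' v w h => exact .a' v w h
  | c v w h => exact .c v w h
  | e v hv h => exact .e v hv h
  | m h => exact .m h

theorem mem_core_of_adj {u v w : Fin n} (huv : u ≠ v) (hu : G.Adj w u) (hv : G.Adj w v) :
    w ∈ (core G).verts :=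
  mem_core_iff.2 ⟨u, v, huv, hu, hv⟩

theorem notMem_closedNbr_of_mem_freeEdges {u v w : Fin n} (hu : u ∈ (core G).verts)
    (h : s(v, w) ∈ freeEdges G) : v ∉ closedNbr G u ∧ w ∉ closedNbr G u := by
  have hne := ne_of_mem_core_of_mem_freeEdges hu h
  rw [mem_freeEdges_iff] at h
  rw [mem_closedNbr, mem_closedNbr]
  constructor
  · rintro (rfl | h1)
    · exact hne.1 rfl
    · exact hne.2 (h.2.1 u h1.symm)
  · rintro (rfl | h1)
    · exact hne.2 rfl
    · exact hne.1 (h.2.2 u h1.symm)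

/-- The support is intersected with `N[u]`. The point of each case is that an empty intersection
rules out a centre of the core, so that 𝔪 really belongs to the poset. -/
theorem PreIdeal.sup_aI (hG : 5 ≤ G.egirth) {I : Ideal (PolyRing k n)} (h : PreIdeal G I)
    {u : Fin n} (hu : u ∈ (core G).verts) : PreIdeal G (I ⊔ aI k G u) := by
  cases h with
  | a v hv =>
    by_cases huv : v = u
    · rw [huv, sup_idem]
      exact .a u hu
    by_cases hadj : G.Adj v u
    · rw [aI_sup_aI_of_adj hG hadj]
      exact .c v u (core_adj_iff.2 ⟨hadj, hv, hu⟩)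
    by_cases hw : ∃ w, G.Adj w v ∧ G.Adj w u
    · obtain ⟨w, hwv, hwu⟩ := hw
      have hwc := mem_core_of_adj huv hwv hwu
      rw [aI_sup_aI_of_common hG huv hwv hwu]
      exact .e w hwc (one_lt_core_ncard_iff.2
        ⟨v, u, huv, core_adj_iff.2 ⟨hwv, hwc, hv⟩, core_adj_iff.2 ⟨hwu, hwc, hu⟩⟩)
    -- A centre of a star would lie in both closed neighbourhoods, which are disjoint here.
    have hdis : ∀ c, (c = v ∨ G.Adj c v) → ¬ (c = u ∨ G.Adj c u) := by
      rintro c (rfl | h1) (h2 | h2)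
      · exact huv h2
      · exact hadj h2
      · subst h2
        exact hadj h1.symm
      · exact hw ⟨c, h1, h2⟩
    rw [aI_eq_std, aI_eq_std, std_sup_std, std_eq_mI]
    · refine .m (hasM_of_no_center hu fun c _ hc => hdis c ?_ ?_)
      · exact (hc v hv).imp Eq.symm id
      · exact (hc u hu).imp Eq.symm id
    · rintro i ⟨h1, h2⟩
      exact hdis i (h1.imp id fun h => h.symm) (h2.imp id fun h => h.symm)
  | a' v w h =>
    have := notMem_closedNbr_of_mem_freeEdges hu h
    rw [aI'_eq_std, aI_eq_std, std_sup_std, std_eq_mI]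
    · exact .m (hasM_of_freeEdges_of_core hu h)
    · rintro i ⟨rfl | rfl, h2⟩
      · exact this.1 h2
      · exact this.2 h2
  | c v w h =>
    rw [core_adj_iff] at h
    obtain ⟨hvw, hv, hw⟩ := h
    rw [cI_eq_std, aI_eq_std, std_sup_std]
    by_cases h1 : v ∈ closedNbr G u <;> by_cases h2 : w ∈ closedNbr G u
    · convert PreIdeal.c v w (core_adj_iff.2 ⟨hvw, hv, hw⟩) using 1
      rw [cI_eq_std, std_eq_std_iff]
      have hT : ({v, w} : Set (Fin n)) ∩ closedNbr G u = {v, w} := by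
        rw [Set.inter_eq_left]
        rintro i (rfl | rfl)
        · exact h1
        · exact h2
      refine ⟨hT, fun i j hij hne hi hj => ?_, fun _ _ h => h.elim⟩
      rw [hT, Set.mem_insert_iff, Set.mem_singleton_iff] at hi hj
      rw [mem_closedNbr] at h1 h2
      have h3 := fun (a : G.Adj u v) (b : G.Adj u w) => not_triangle_of_girth hG a hvw b
      have h4 : ¬ G.Adj u u := G.loopless.irrefl u
      grind
    · have huv : G.Adj v u := by
        rcases h1 with rfl | h1
        · exact (h2 (Or.inr hvw)).elim
        · exact h1.symm
      rw [std_eq_eI (v := v)]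
      · refine .e v hv (one_lt_core_ncard_iff.2 ⟨u, w, ?_, core_adj_iff.2 ⟨huv, hv, hu⟩,
          core_adj_iff.2 ⟨hvw, hv, hw⟩⟩)
        rintro rfl
        exact h2 (Or.inl rfl)
      · intro i
        constructor
        · rintro ⟨rfl | rfl, h3⟩
          · rfl
          · exact (h2 h3).elim
        · rintro rfl
          exact ⟨Or.inl rfl, h1⟩
    · have huw : G.Adj w u := by
        rcases h2 with rfl | h2
        · exact (h1 (Or.inr hvw.symm)).elim
        · exact h2.symm
      rw [std_eq_eI (v := w)]
      · refine .e w hw (one_lt_core_ncard_iff.2 ⟨u, v, ?_, core_adj_iff.2 ⟨huw, hw, hu⟩,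
          core_adj_iff.2 ⟨hvw.symm, hw, hv⟩⟩)
        rintro rfl
        exact h1 (Or.inl rfl)
      · intro i
        constructor
        · rintro ⟨rfl | rfl, h3⟩
          · exact (h1 h3).elim
          · rfl
        · rintro rfl
          exact ⟨Or.inr rfl, h2⟩
    · rw [std_eq_mI]
      -- A centre `c` cannot be `v` or `w`, which are outside `N[u]`; otherwise it forms a triangle
      -- with the edge `{v, w}`.
      · refine .m (hasM_of_no_center hu fun c _ hc => ?_)
        have hcu := hc u hu
        rcases hc v hv with rfl | hcv
        · exact h1 (hcu.imp Eq.symm fun h => h.symm)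
        rcases hc w hw with rfl | hcw
        · exact h2 (hcu.imp Eq.symm fun h => h.symm)
        exact not_triangle_of_girth hG hcv hvw hcw
      · rintro i ⟨rfl | rfl, h3⟩
        · exact h1 h3
        · exact h2 h3
  | e v hv h =>
    rw [eI_eq_std, aI_eq_std, std_sup_std]
    by_cases h1 : v ∈ closedNbr G u
    · rw [std_eq_eI (v := v)]
      · exact .e v hv h
      · intro i
        constructor
        · exact fun h => h.1
        · rintro rfl
          exact ⟨rfl, h1⟩
    · rw [std_eq_mI]
      · obtain ⟨a, b, hab, ha, hb⟩ := one_lt_core_ncard_iff.1 h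
        rw [core_adj_iff] at ha hb
        refine .m (hasM_of_no_center hu fun c _ hc => ?_)
        rcases hc v hv with rfl | hcv
        · exact h1 ((hc u hu).imp Eq.symm fun h => h.symm)
        -- A centre `c ≠ v` is adjacent to `v`, so a core neighbour of `v` other than `c` closes a
        -- triangle; but `v` has two core neighbours.
        have key : ∀ a, G.Adj v a → a ∈ (core G).verts → a = c := fun a ha hac =>
          (hc a hac).resolve_right fun h => not_triangle_of_girth hG hcv ha h
        exact hab ((key a ha.1 ha.2.2).trans (key b hb.1 hb.2.2).symm)
      · rintro i ⟨rfl, h3⟩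
        exact h1 h3
  | m h =>
    rw [aI_eq_std, mI_sup_std]
    exact .m h

theorem PreIdeal.sup_aI' {I : Ideal (PolyRing k n)} (h : PreIdeal G I)
    {a b : Fin n} (hab : s(a, b) ∈ freeEdges G) : PreIdeal G (I ⊔ aI' k a b) := by
  cases h with
  | a u hu =>
    have := notMem_closedNbr_of_mem_freeEdges hu hab
    rw [aI'_eq_std, aI_eq_std, std_sup_std, std_eq_mI]
    · exact .m (hasM_of_freeEdges_of_core hu hab)
    · rintro i ⟨h2, rfl | rfl⟩
      · exact this.1 h2
      · exact this.2 h2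
  | a' v w h =>
    by_cases he : s(v, w) = s(a, b)
    · have : aI' k v w = aI' k a b := by
        rw [Sym2.eq_iff] at he
        rcases he with ⟨rfl, rfl⟩ | ⟨rfl, rfl⟩
        · rfl
        · rw [aI', aI', Set.pair_comm]
      rw [this, sup_idem]
      exact .a' a b hab
    · rw [aI'_eq_std, aI'_eq_std, std_sup_std, std_eq_mI]
      · exact .m (hasM_of_freeEdges_ne h hab he)
      · rw [mem_freeEdges_iff] at h hab
        rw [Sym2.eq_iff] at he
        obtain ⟨h1, h2, h3⟩ := h
        obtain ⟨h4, h5, h6⟩ := hab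
        rintro i ⟨rfl | rfl, rfl | rfl⟩
        · exact he (Or.inl ⟨rfl, h5 w h1⟩)
        · exact he (Or.inr ⟨rfl, h6 w h1⟩)
        · exact he (Or.inr ⟨h5 v h1.symm, rfl⟩)
        · exact he (Or.inl ⟨h6 v h1.symm, rfl⟩)
  | c v w h =>
    obtain ⟨_, hv, hw⟩ := core_adj_iff.1 h
    have h1 := ne_of_mem_core_of_mem_freeEdges hv hab
    have h2 := ne_of_mem_core_of_mem_freeEdges hw hab
    rw [cI_eq_std, aI'_eq_std, std_sup_std, std_eq_mI]
    · exact .m (hasM_of_freeEdges_of_core hv hab)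
    · rintro i ⟨rfl | rfl, rfl | rfl⟩
      exacts [h1.1 rfl, h1.2 rfl, h2.1 rfl, h2.2 rfl]
  | e v hv h =>
    have h1 := ne_of_mem_core_of_mem_freeEdges hv hab
    rw [eI_eq_std, aI'_eq_std, std_sup_std, std_eq_mI]
    · exact .m (hasM_of_freeEdges_of_core hv hab)
    · rintro i ⟨rfl, rfl | rfl⟩
      exacts [h1.1 rfl, h1.2 rfl]
  | m h =>
    rw [aI'_eq_std, mI_sup_std]
    exact .m h

theorem PreIdeal.sup_jI {I : Ideal (PolyRing k n)} (h : PreIdeal G I) :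
    PIdeal k G (I ⊔ jI k n) := by
  cases h with
  | a v hv => rw [aI_sup_jI]; exact .b v hv
  | a' v w h => rw [aI'_sup_jI]; exact .b' v w h
  | c v w h => rw [cI_sup_jI]; exact .d v w h
  | e v hv h => rw [eI_sup_jI]; exact .e v hv h
  | m h => rw [mI_sup_jI]; exact .m h

theorem PIdeal.eq_or {I : Ideal (PolyRing k n)} (h : PIdeal k G I) :
    I = jI k n ∨ PreIdeal G I ∨ ∃ I₀, PreIdeal G I₀ ∧ I = I₀ ⊔ jI k n := by
  cases h with
  | j => exact Or.inl rfl
  | a v hv => exact Or.inr (Or.inl (.a v hv))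
  | a' v w h => exact Or.inr (Or.inl (.a' v w h))
  | b v hv => exact Or.inr (Or.inr ⟨_, .a v hv, (aI_sup_jI v).symm⟩)
  | b' v w h => exact Or.inr (Or.inr ⟨_, .a' v w h, (aI'_sup_jI v w).symm⟩)
  | c v w h => exact Or.inr (Or.inl (.c v w h))
  | d v w h => exact Or.inr (Or.inr ⟨_, .c v w h, (cI_sup_jI v w).symm⟩)
  | e v hv h => exact Or.inr (Or.inl (.e v hv h))
  | m h => exact Or.inr (Or.inl (.m h))

/-- By `PIdeal.eq_or` the ideals are 𝔧, a `PreIdeal`, or a `PreIdeal` plus 𝔧. As sums are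
idempotent, the summand 𝔧 can be split off and added last, leaving sums with 𝔞_v and 𝔞'_{v,w}. -/
theorem PIdeal.sup_minIdeal (hG : 5 ≤ G.egirth) {I I' : Ideal (PolyRing k n)}
    (h : PIdeal k G I) (h' : MinIdeal k G I') : PIdeal k G (I ⊔ I') := by
  by_cases hj : I' = jI k n
  · subst hj
    rcases h.eq_or with rfl | hI | ⟨I₀, hI, rfl⟩
    · rw [sup_idem]; exact .j
    · exact hI.sup_jI
    · rw [sup_assoc, sup_idem]; exact hI.sup_jI
  have hpre : ∀ {I}, PreIdeal G I → PreIdeal G (I ⊔ I') := by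
    intro I h
    cases h' with
    | j => exact (hj rfl).elim
    | a v hv => exact h.sup_aI hG hv
    | a' v w hvw => exact h.sup_aI' hvw
  have hpre' : PreIdeal G I' := by
    cases h' with
    | j => exact (hj rfl).elim
    | a v hv => exact .a v hv
    | a' v w hvw => exact .a' v w hvw
  rcases h.eq_or with rfl | hI | ⟨I₀, hI, rfl⟩
  · rw [sup_comm]
    exact hpre'.sup_jI
  · exact (hpre hI).pIdeal
  · rw [sup_right_comm]
    exact (hpre hI).sup_jI

/-! ### The elements of the poset -/

/-- `I` is a sum of finitely many minimal primes of `J(Gᶜ)`. -/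
def IsSum (G : SimpleGraph (Fin n)) (I : Ideal (PolyRing k n)) : Prop :=
  ∃ s : Finset (Ideal (PolyRing k n)), s.Nonempty ∧ (∀ I ∈ s, MinIdeal k G I) ∧ I = s.sup id

theorem MinIdeal.isSum {I : Ideal (PolyRing k n)} (h : MinIdeal k G I) : IsSum G I :=
  ⟨{I}, Finset.singleton_nonempty _, by simpa using h, by simp⟩

theorem IsSum.sup {I I' : Ideal (PolyRing k n)} (h : IsSum G I) (h' : IsSum G I') :
    IsSum G (I ⊔ I') := by
  classical
  obtain ⟨s, hs, hsm, rfl⟩ := h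
  obtain ⟨s', -, hsm', rfl⟩ := h'
  refine ⟨s ∪ s', hs.mono Finset.subset_union_left, fun I hI => ?_, by rw [Finset.sup_union]⟩
  exact (Finset.mem_union.1 hI).elim (hsm I) (hsm' I)

theorem isSum_mI_of_not_isStar (hG : 5 ≤ G.egirth) {v : Fin n} (hv : v ∈ (core G).verts)
    (hstar : ¬ IsStar (core G)) : IsSum G (mI k n) := by
  classical
  set s : Finset (Ideal (PolyRing k n)) :=
    (Finset.univ.filter fun v => v ∈ (core G).verts).image (aI k G) with hs
  have hmem : ∀ v ∈ (core G).verts, aI k G v ∈ s := fun v hv =>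
    Finset.mem_image_of_mem _ (Finset.mem_filter.2 ⟨Finset.mem_univ v, hv⟩)
  have hs' : ∀ I ∈ s, ∃ v ∈ (core G).verts, I = aI k G v := by
    intro I hI
    obtain ⟨v, hv, rfl⟩ := Finset.mem_image.1 hI
    exact ⟨v, (Finset.mem_filter.1 hv).2, rfl⟩
  refine ⟨s, ⟨_, hmem v hv⟩, fun I hI => ?_, le_antisymm ?_ ?_⟩
  · obtain ⟨v, hv, rfl⟩ := hs' I hI
    exact .a v hv
  -- A vertex `i` in every `N[v]`, `v` in the core, would make the core a star: with centre `i` if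
  -- `i` is in the core; otherwise `i` is a leaf at `v`, and `v` is the only core vertex.
  · have hex : ∀ i, ∃ v ∈ (core G).verts, i ∉ closedNbr G v := by
      intro i
      by_contra! hcon
      have hi : i ∈ (core G).verts := by
        rcases hcon v hv with rfl | hvi
        · exact hv
        obtain ⟨a, b, hab, ha, hb⟩ := mem_core_iff.1 hv
        by_contra hi
        have hNi : ∀ u, G.Adj i u → u = v := by
          intro u hu
          by_contra huv
          exact hi (mem_core_of_adj huv hu hvi.symm)
        refine hstar (isStar_of_center hG hv fun u hu => ?_)
        rcases hcon u hu with rfl | h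
        · exact (hi hu).elim
        · exact Or.inl (hNi u h.symm)
      exact hstar (isStar_of_center hG hi fun u hu =>
        (hcon u hu).imp Eq.symm fun h => h.symm)
    rw [mI, Ideal.span_le]
    rintro _ ⟨i | i, rfl⟩
    · obtain ⟨v, hv, hi⟩ := hex i
      refine Finset.le_sup (f := id) (hmem v hv) ?_
      rw [id, aI_eq_std]
      exact x_mem_std hi
    · obtain ⟨v, hv, hi⟩ := hex i
      refine Finset.le_sup (f := id) (hmem v hv) ?_
      rw [id, aI_eq_std]
      exact y_mem_std hi
  · refine Finset.sup_le fun I hI => ?_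
    obtain ⟨v, -, rfl⟩ := hs' I hI
    rw [id, aI_eq_std, ← mI_sup_std (closedNbr G v) fun i j => G.Adj v i ∧ G.Adj v j]
    exact le_sup_right

theorem isSum_mI (hG : 5 ≤ G.egirth) (h : HasM G) : IsSum G (mI k n) := by
  rcases h with h | ⟨⟨u, hu⟩, ⟨e, he⟩ | h⟩
  · obtain ⟨e, he, e', he', hne⟩ := (Set.one_lt_ncard).1 h
    induction e using Sym2.ind with
    | _ v w =>
    induction e' using Sym2.ind with
    | _ a b =>
    have := ((MinIdeal.a' (k := k) v w he).isSum).sup (MinIdeal.a' (k := k) a b he').isSum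
    rwa [aI'_eq_std, aI'_eq_std, std_sup_std, std_eq_mI] at this
    rw [mem_freeEdges_iff] at he he'
    rw [ne_eq, Sym2.eq_iff] at hne
    obtain ⟨h1, h2, h3⟩ := he
    obtain ⟨h4, h5, h6⟩ := he'
    rintro i ⟨rfl | rfl, rfl | rfl⟩
    · exact hne (Or.inl ⟨rfl, h5 w h1⟩)
    · exact hne (Or.inr ⟨rfl, h6 w h1⟩)
    · exact hne (Or.inr ⟨h5 v h1.symm, rfl⟩)
    · exact hne (Or.inl ⟨h6 v h1.symm, rfl⟩)
  · induction e using Sym2.ind with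
    | _ v w =>
    have := ((MinIdeal.a' (k := k) v w he).isSum).sup (MinIdeal.a (k := k) u hu).isSum
    have hn := notMem_closedNbr_of_mem_freeEdges hu he
    rwa [aI'_eq_std, aI_eq_std, std_sup_std, std_eq_mI] at this
    rintro i ⟨rfl | rfl, h2⟩
    · exact hn.1 h2
    · exact hn.2 h2
  · exact isSum_mI_of_not_isStar hG hu h

theorem PIdeal.isSum (hG : 5 ≤ G.egirth) {I : Ideal (PolyRing k n)} (h : PIdeal k G I) :
    IsSum G I := by
  have hc : ∀ {v w}, (core G).Adj v w → IsSum G (cI k v w) := by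
    intro v w h
    obtain ⟨hvw, hv, hw⟩ := core_adj_iff.1 h
    rw [← aI_sup_aI_of_adj hG hvw]
    exact (MinIdeal.a v hv).isSum.sup (MinIdeal.a w hw).isSum
  cases h with
  | j => exact MinIdeal.j.isSum
  | a v hv => exact (MinIdeal.a v hv).isSum
  | a' v w h => exact (MinIdeal.a' v w h).isSum
  | b v hv =>
    rw [← aI_sup_jI]
    exact (MinIdeal.a v hv).isSum.sup MinIdeal.j.isSum
  | b' v w h =>
    rw [← aI'_sup_jI]
    exact (MinIdeal.a' v w h).isSum.sup MinIdeal.j.isSum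
  | c v w h => exact hc h
  | d v w h =>
    rw [← cI_sup_jI]
    exact (hc h).sup MinIdeal.j.isSum
  | e v hv h =>
    obtain ⟨a, b, hab, ha, hb⟩ := one_lt_core_ncard_iff.1 h
    rw [core_adj_iff] at ha hb
    rw [← aI_sup_aI_of_common hG hab ha.1 hb.1]
    exact (MinIdeal.a a ha.2.2).isSum.sup (MinIdeal.a b hb.2.2).isSum
  | m h => exact isSum_mI hG h

/-- Writing `I'` as a sum of minimal primes reduces this to adding one minimal prime at a time. -/
theorem PIdeal.sup (hG : 5 ≤ G.egirth) {I I' : Ideal (PolyRing k n)} (h : PIdeal k G I)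
    (h' : PIdeal k G I') : PIdeal k G (I ⊔ I') := by
  classical
  obtain ⟨s, -, hs, rfl⟩ := h'.isSum hG
  clear h'
  induction s using Finset.induction_on with
  | empty => rwa [Finset.sup_empty, sup_bot_eq]
  | insert J s _ ih =>
    rw [Finset.sup_insert, id, sup_comm J, ← sup_assoc]
    exact (ih fun I hI => hs I (Finset.mem_insert_of_mem hI)).sup_minIdeal hG
      (hs J (Finset.mem_insert_self J s))

theorem pIdeal_finset_sup (hG : 5 ≤ G.egirth) {s : Finset (Ideal (PolyRing k n))}
    (hne : s.Nonempty) (hs : ∀ I ∈ s, PIdeal k G I) : PIdeal k G (s.sup id) := by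
  classical
  induction hne using Finset.Nonempty.cons_induction with
  | singleton I => simpa using hs I
  | cons I s h _ ih =>
    rw [Finset.sup_cons]
    exact (hs I (Finset.mem_cons_self I s)).sup hG
      (ih fun I hI => hs I (Finset.mem_cons_of_mem hI))

/-- Sums of ideals of the poset are again in it, hence prime, so the decomposition branch is
vacuous; the minimal primes alone already generate everything as sums. One round therefore reaches
the whole set, and further rounds fix it. -/
theorem sumStep_eq (hG : 5 ≤ G.egirth) {A : Set (Ideal (PolyRing k n))}
    (hmin : ∀ I, MinIdeal k G I → I ∈ A) (hA : ∀ I ∈ A, PIdeal k G I) :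
    sumStep k A = {I | PIdeal k G I} := by
  have hsum : ∀ s : Finset (Ideal (PolyRing k n)), ∑ I ∈ s, I = s.sup id := fun s =>
    Ideal.sum_eq_sup s id
  ext p
  constructor
  · rintro ⟨s, hne, hs, h⟩
    rw [hsum] at h
    have hp := pIdeal_finset_sup hG hne fun I hI => hA I (hs I hI)
    rcases h with ⟨-, rfl⟩ | ⟨h, -⟩
    · exact hp
    · exact (h (isPrime_of_pIdeal k G hp)).elim
  · intro hp
    obtain ⟨s, hne, hs, h⟩ := PIdeal.isSum hG hp
    refine ⟨s, hne, fun I hI => hmin I (hs I hI), Or.inl ?_⟩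
    rw [hsum, ← h]
    exact ⟨isPrime_of_pIdeal k G hp, rfl⟩

theorem qIdeals_compl_eq (hG : 5 ≤ G.egirth) (huniv : ∀ v, ¬ G.IsUniversal v) :
    qIdeals k Gᶜ = {I | PIdeal k G I} := by
  have hstep : ∀ m, (∀ I, MinIdeal k G I → I ∈ (sumStep k)^[m] {I | MinIdeal k G I}) ∧
      ∀ I ∈ (sumStep k)^[m] {I | MinIdeal k G I}, PIdeal k G I := by
    intro m
    induction m with
    | zero => exact ⟨fun I h => h, fun I h => MinIdeal.pIdeal h⟩
    | succ m ih =>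
      rw [Function.iterate_succ_apply', sumStep_eq hG ih.1 ih.2]
      exact ⟨fun I h => h.pIdeal, fun I h => h⟩
  rw [qIdeals, associatedPrimes_edgeIdeal_compl hG huniv]
  apply Set.Subset.antisymm
  · exact Set.iUnion_subset fun m => (hstep m).2
  · refine Set.subset_iUnion_of_subset 1 ?_
    rw [Function.iterate_succ_apply', sumStep_eq hG (hstep 0).1 (hstep 0).2]

end Sums

section Order

variable {k : Type*} [Field k] {n : ℕ} {G : SimpleGraph (Fin n)}

/-! ### The generated order is contained in reverse inclusion -/

theorem elt_le_elt {I I' : Ideal (PolyRing k n)} : elt I ≤ elt I' ↔ I' ≤ I :=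
  WithTop.coe_le_coe.trans Iff.rfl

theorem PRel.le {p q : RevIdeals k n} (h : PRel k G p q) : p ≤ q := by
  have hm : ∀ {T : Set (Fin n)} {E : Fin n → Fin n → Prop}, std k T E ≤ mI k n := by
    intro T E
    rw [← mI_sup_std T E]
    exact le_sup_right
  cases h with
  | m_b' => rw [elt_le_elt, bI'_eq_std]; exact hm
  | m_e => rw [elt_le_elt, eI_eq_std]; exact hm
  | m_d => rw [elt_le_elt, dI_eq_std]; exact hm
  | m_b => rw [elt_le_elt, bI_eq_std]; exact hm
  | e_d v w =>
    rw [elt_le_elt, dI_eq_std, eI_eq_std, std_le_std_iff]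
    exact ⟨by simp, fun _ _ _ _ _ _ => Or.inl trivial⟩
  | d_b_left v w h =>
    rw [elt_le_elt, dI_eq_std, bI_eq_std, std_le_std_iff]
    refine ⟨?_, fun _ _ _ _ _ _ => Or.inl trivial⟩
    rintro i (rfl | rfl)
    · exact Or.inl rfl
    · exact Or.inr (core_adj_iff.1 h).1
  | d_b_right v w h =>
    rw [elt_le_elt, dI_eq_std, bI_eq_std, std_le_std_iff]
    refine ⟨?_, fun _ _ _ _ _ _ => Or.inl trivial⟩
    rintro i (rfl | rfl)
    · exact Or.inr (core_adj_iff.1 h).1.symm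
    · exact Or.inl rfl
  | d_c => rw [elt_le_elt, ← cI_sup_jI]; exact le_sup_left
  | c_a_left v w h =>
    rw [elt_le_elt, cI_eq_std, aI_eq_std, std_le_std_iff]
    have hvw := (core_adj_iff.1 h).1
    constructor
    · rintro i (rfl | rfl)
      · exact Or.inl rfl
      · exact Or.inr hvw
    · intro i j hij hne hi hj
      rw [Set.mem_insert_iff, Set.mem_singleton_iff] at hi hj
      have := G.loopless.irrefl v
      grind
  | c_a_right v w h =>
    rw [elt_le_elt, cI_eq_std, aI_eq_std, std_le_std_iff]
    have hvw := (core_adj_iff.1 h).1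
    constructor
    · rintro i (rfl | rfl)
      · exact Or.inr hvw.symm
      · exact Or.inl rfl
    · intro i j hij hne hi hj
      rw [Set.mem_insert_iff, Set.mem_singleton_iff] at hi hj
      have := G.loopless.irrefl w
      grind
  | b'_j => rw [elt_le_elt, ← aI'_sup_jI]; exact le_sup_right
  | b'_a' => rw [elt_le_elt, ← aI'_sup_jI]; exact le_sup_left
  | b_j => rw [elt_le_elt, ← aI_sup_jI]; exact le_sup_right
  | b_a => rw [elt_le_elt, ← aI_sup_jI]; exact le_sup_left
  | j_top => exact le_top
  | a_top => exact le_top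
  | a'_top => exact le_top

theorem le_of_pLE {p q : RevIdeals k n} (h : pLE k G p q) : p ≤ q := by
  induction h with
  | refl => exact le_rfl
  | tail _ h ih => exact ih.trans h.le

/-! ### Chains in the generated order -/

theorem pLE_refl_of_eq {I I' : Ideal (PolyRing k n)} (h : I = I') : pLE k G (elt I) (elt I') := by
  rw [h]
  exact .refl

theorem pLE_e_b {u v : Fin n} (hv : v ∈ (core G).verts) (hu : u ∈ (core G).verts)
    (h : 1 < ((core G).neighborSet v).ncard) (hvu : v ∈ closedNbr G u) :
    pLE k G (elt (eI k v)) (elt (bI k G u)) := by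
  rcases hvu with rfl | hadj
  · obtain ⟨a, b, -, ha, -⟩ := one_lt_core_ncard_iff.1 h
    exact (Relation.ReflTransGen.single (.e_d v a h ha)).tail (.d_b_left v a ha)
  · have hvu : (core G).Adj v u := core_adj_iff.2 ⟨hadj.symm, hv, hu⟩
    exact (Relation.ReflTransGen.single (.e_d v u h hvu)).tail (.d_b_right v u hvu)

theorem one_lt_or_neighborSet_eq {v w : Fin n} (h : (core G).Adj v w) :
    1 < ((core G).neighborSet v).ncard ∨ (core G).neighborSet v = {w} := by
  rw [or_iff_not_imp_left, one_lt_core_ncard_iff]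
  intro hcon
  ext u
  rw [SimpleGraph.Subgraph.mem_neighborSet, Set.mem_singleton_iff]
  constructor
  · intro hu
    by_contra huw
    exact hcon ⟨u, w, huw, hu, h⟩
  · rintro rfl
    exact h

theorem dI_comm (v w : Fin n) : dI k v w = dI k w v := by
  rw [dI_eq_std, dI_eq_std, Set.pair_comm]

/-- If an endpoint has two core neighbours, the chain passes through its 𝔢; otherwise `{v, w}` is a
component of the core and the relation is a generator. -/
theorem pLE_m_d (hm : HasM G) {v w : Fin n} (h : (core G).Adj v w) :
    pLE k G (elt (mI k n)) (elt (dI k v w)) := by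
  rcases one_lt_or_neighborSet_eq h with h1 | h1
  · exact (Relation.ReflTransGen.single (.m_e hm v (core_adj_iff.1 h).2.1 h1)).tail
      (.e_d v w h1 h)
  rcases one_lt_or_neighborSet_eq h.symm with h2 | h2
  · rw [dI_comm]
    exact (Relation.ReflTransGen.single (.m_e hm w (core_adj_iff.1 h).2.2 h2)).tail
      (.e_d w v h2 h.symm)
  · exact .single (.m_d hm v w h1 h2)

theorem pLE_m_b (hm : HasM G) {v : Fin n} (hv : v ∈ (core G).verts) :
    pLE k G (elt (mI k n)) (elt (bI k G v)) := by
  by_cases h : ∃ w, (core G).Adj v w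
  · obtain ⟨w, hw⟩ := h
    exact (pLE_m_d hm hw).tail (.d_b_left v w hw)
  · refine .single (.m_b hm v hv (Set.eq_empty_of_forall_notMem fun w hw => h ⟨w, hw⟩))

/-- Each alternative in `HasM` yields a free edge or a core vertex, so the chain passes through some
𝔟' or 𝔟. -/
theorem pLE_m_j (hm : HasM G) : pLE k G (elt (mI k n)) (elt (jI k n)) := by
  have hfree : (freeEdges G).Nonempty → pLE k G (elt (mI k n)) (elt (jI k n)) := by
    rintro ⟨e, he⟩
    induction e using Sym2.ind with
    | _ v w => exact (Relation.ReflTransGen.single (.m_b' hm v w he)).tail (.b'_j v w he)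
  rcases id hm with h | ⟨⟨v, hv⟩, -⟩
  · exact hfree (Set.nonempty_of_ncard_ne_zero (by omega))
  · exact (pLE_m_b hm hv).tail (.b_j v hv)

theorem pLE_top {I : Ideal (PolyRing k n)} (h : PIdeal k G I) : pLE k G (elt I) ⊤ := by
  have hj : pLE k G (elt (jI k n)) ⊤ := .single .j_top
  cases h with
  | j => exact hj
  | a v hv => exact .single (.a_top v hv)
  | a' v w h => exact .single (.a'_top v w h)
  | b v hv => exact .head (.b_j v hv) hj
  | b' v w h => exact .head (.b'_j v w h) hj
  | c v w h => exact .head (.c_a_left v w h) (.single (.a_top v (core_adj_iff.1 h).2.1))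
  | d v w h =>
    exact .head (.d_b_left v w h) (.head (.b_j v (core_adj_iff.1 h).2.1) hj)
  | e v hv h => exact (pLE_e_b hv hv h (Or.inl rfl)).trans (.head (.b_j v hv) hj)
  | m h => exact (pLE_m_j h).trans hj

/-! ### Reverse inclusion is contained in the generated order -/

theorem not_closedNbr_subset_pair {v a b : Fin n} (hv : v ∈ (core G).verts) :
    ¬ closedNbr G v ⊆ {a, b} := by
  intro h
  obtain ⟨c, d, hcd, hc, hd⟩ := mem_core_iff.1 hv
  have h1 := h (Or.inl rfl : v ∈ closedNbr G v)
  have h2 := h (Or.inr hc : c ∈ closedNbr G v)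
  have h3 := h (Or.inr hd : d ∈ closedNbr G v)
  rw [Set.mem_insert_iff, Set.mem_singleton_iff] at h1 h2 h3
  have := hc.ne
  have := hd.ne
  grind

theorem eq_of_closedNbr_subset (hG : 5 ≤ G.egirth) {u v : Fin n} (hv : v ∈ (core G).verts)
    (h : closedNbr G v ⊆ closedNbr G u) : v = u := by
  by_contra hvu
  have huv : G.Adj u v := (h (Or.inl rfl : v ∈ closedNbr G v)).resolve_left hvu
  obtain ⟨a, b, hab, ha, hb⟩ := mem_core_iff.1 hv
  have key : ∀ c, G.Adj v c → c = u := fun c hc =>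
    (h (Or.inr hc : c ∈ closedNbr G v)).resolve_right fun h =>
      not_triangle_of_girth hG huv hc h
  exact hab ((key a ha).trans (key b hb).symm)

theorem not_univ_subset_closedNbr (huniv : ∀ v, ¬ G.IsUniversal v) (v : Fin n) :
    ¬ Set.univ ⊆ closedNbr G v := fun h =>
  huniv v fun w hvw => (h (Set.mem_univ w)).resolve_left hvw.symm

theorem not_univ_subset_pair (huniv : ∀ v, ¬ G.IsUniversal v) {a b : Fin n} (hab : G.Adj a b) :
    ¬ Set.univ ⊆ ({a, b} : Set (Fin n)) := by
  intro h
  refine not_univ_subset_closedNbr huniv a fun i hi => ?_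
  rcases h hi with rfl | rfl
  · exact Or.inl rfl
  · exact Or.inr hab

/-- The binomial `δ_{v,w}` is the obstruction: the centre `v` is in no binomial generator of 𝔞_v. -/
theorem not_std_true_le_aI {v w : Fin n} {T : Set (Fin n)} (hvw : G.Adj v w) :
    ¬ (std k T fun _ _ => True) ≤ aI k G v := by
  rw [aI_eq_std, std_le_std_iff]
  intro h
  have := h.2 v w trivial hvw.ne (Or.inl rfl) (Or.inr hvw)
  simp at this

theorem not_std_true_le_cI {v w : Fin n} {T : Set (Fin n)} (hvw : G.Adj v w) :
    ¬ (std k T fun _ _ => True) ≤ cI k v w := by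
  rw [cI_eq_std, std_le_std_iff]
  intro h
  have := h.2 v w trivial hvw.ne (by simp) (by simp)
  simp at this

/-- The vertices whose variables do not lie in `I`. -/
def supp (I : Ideal (PolyRing k n)) : Set (Fin n) := {i | x k i ∉ I}

theorem supp_std (T : Set (Fin n)) (E : Fin n → Fin n → Prop) : supp (std k T E) = T := by
  ext i
  constructor
  · intro h
    by_contra hi
    exact h (x_mem_std hi)
  · intro hi h
    exact not_mem_of_x_mem_std h hi

theorem supp_anti {I I' : Ideal (PolyRing k n)} (h : I ≤ I') : supp I' ⊆ supp I :=
  fun _ hi hx => hi (h hx)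

theorem supp_jI : supp (jI k n) = Set.univ := by rw [jI_eq_std, supp_std]
theorem supp_aI (v : Fin n) : supp (aI k G v) = closedNbr G v := by rw [aI_eq_std, supp_std]
theorem supp_bI (v : Fin n) : supp (bI k G v) = closedNbr G v := by rw [bI_eq_std, supp_std]
theorem supp_aI' (v w : Fin n) : supp (aI' k v w) = {v, w} := by rw [aI'_eq_std, supp_std]
theorem supp_bI' (v w : Fin n) : supp (bI' k v w) = {v, w} := by rw [bI'_eq_std, supp_std]
theorem supp_cI (v w : Fin n) : supp (cI k v w) = {v, w} := by rw [cI_eq_std, supp_std]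
theorem supp_dI (v w : Fin n) : supp (dI k v w) = {v, w} := by rw [dI_eq_std, supp_std]
theorem supp_eI (v : Fin n) : supp (eI k v) = {v} := by rw [eI_eq_std, supp_std]
theorem supp_mI : supp (mI k n) = ∅ := by rw [mI_eq_std, supp_std]

theorem pair_eq_pair_of_subset {v w a b : Fin n} (hvw : v ≠ w)
    (h : ({v, w} : Set (Fin n)) ⊆ {a, b}) : ({v, w} : Set (Fin n)) = {a, b} := by
  rcases pair_eq_of_adj hvw h with ⟨rfl, rfl⟩ | ⟨rfl, rfl⟩
  · rfl
  · exact Set.pair_comm _ _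

variable {I : Ideal (PolyRing k n)}

theorem pLE_jI (h : PIdeal k G I) (hle : jI k n ≤ I) : pLE k G (elt I) (elt (jI k n)) := by
  have hle' := hle
  rw [jI_eq_std] at hle'
  cases h with
  | j => exact .refl
  | a v hv =>
    obtain ⟨a, -, -, ha, -⟩ := mem_core_iff.1 hv
    exact (not_std_true_le_aI ha hle').elim
  | a' v w h => exact (not_std_true_le_cI (mem_freeEdges_iff.1 h).1 hle').elim
  | b v hv => exact .single (.b_j v hv)
  | b' v w h => exact .single (.b'_j v w h)
  | c v w h => exact (not_std_true_le_cI (core_adj_iff.1 h).1 hle').elim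
  | d v w h => exact .head (.d_b_left v w h) (.single (.b_j v (core_adj_iff.1 h).2.1))
  | e v hv h => exact (pLE_e_b hv hv h (Or.inl rfl)).tail (.b_j v hv)
  | m h => exact pLE_m_j h

theorem pLE_aI (hG : 5 ≤ G.egirth) (huniv : ∀ v, ¬ G.IsUniversal v) (h : PIdeal k G I)
    {u : Fin n} (hu : u ∈ (core G).verts) (hle : aI k G u ≤ I) :
    pLE k G (elt I) (elt (aI k G u)) := by
  have hs := supp_anti hle
  rw [supp_aI] at hs
  -- An edge inside `N[u]` must contain `u`, else it forms a triangle with `u`.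
  have hpair : ∀ {v w}, (core G).Adj v w → ({v, w} : Set (Fin n)) ⊆ closedNbr G u →
      v = u ∨ w = u := by
    intro v w hvw h
    have h1 := h (by simp : v ∈ ({v, w} : Set (Fin n)))
    have h2 := h (by simp : w ∈ ({v, w} : Set (Fin n)))
    by_contra! hcon
    exact not_triangle_of_girth hG (h1.resolve_left hcon.1) (core_adj_iff.1 hvw).1
      (h2.resolve_left hcon.2)
  have hc : ∀ {v w}, (core G).Adj v w → ({v, w} : Set (Fin n)) ⊆ closedNbr G u →
      PRel k G (elt (cI k v w)) (elt (aI k G u)) := by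
    intro v w hvw h
    rcases hpair hvw h with rfl | rfl
    · exact .c_a_left _ _ hvw
    · exact .c_a_right _ _ hvw
  cases h with
  | j => exact pLE_refl_of_eq (minIdeal_antichain hG huniv (.a u hu) .j hle).symm
  | a v hv => exact pLE_refl_of_eq (minIdeal_antichain hG huniv (.a u hu) (.a v hv) hle).symm
  | a' v w h =>
    exact pLE_refl_of_eq (minIdeal_antichain hG huniv (.a u hu) (.a' v w h) hle).symm
  | b v hv =>
    rw [supp_bI] at hs
    obtain rfl := eq_of_closedNbr_subset hG hv hs
    exact .single (.b_a v hv)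
  | b' v w h =>
    rw [supp_bI'] at hs
    exact ((notMem_closedNbr_of_mem_freeEdges hu h).1 (hs (by simp))).elim
  | c v w h =>
    rw [supp_cI] at hs
    exact .single (hc h hs)
  | d v w h =>
    rw [supp_dI] at hs
    exact .head (.d_c v w h) (.single (hc h hs))
  | e v hv h =>
    rw [supp_eI] at hs
    exact (pLE_e_b hv hu h (hs rfl)).tail (.b_a u hu)
  | m h => exact (pLE_m_b h hu).tail (.b_a u hu)

theorem not_subset_of_mem_freeEdges {v a b : Fin n} (hv : v ∈ (core G).verts)
    (hab : s(a, b) ∈ freeEdges G) : v ∉ ({a, b} : Set (Fin n)) := by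
  have := ne_of_mem_core_of_mem_freeEdges hv hab
  rintro (h | h)
  · exact this.1 h
  · exact this.2 h

theorem pLE_aI' (hG : 5 ≤ G.egirth) (huniv : ∀ v, ¬ G.IsUniversal v) (h : PIdeal k G I)
    {a b : Fin n} (hab : s(a, b) ∈ freeEdges G) (hle : aI' k a b ≤ I) :
    pLE k G (elt I) (elt (aI' k a b)) := by
  have hs := supp_anti hle
  rw [supp_aI'] at hs
  cases h with
  | j => exact pLE_refl_of_eq (minIdeal_antichain hG huniv (.a' a b hab) .j hle).symm
  | a v hv =>
    exact pLE_refl_of_eq (minIdeal_antichain hG huniv (.a' a b hab) (.a v hv) hle).symm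
  | a' v w h =>
    exact pLE_refl_of_eq (minIdeal_antichain hG huniv (.a' a b hab) (.a' v w h) hle).symm
  | b v hv =>
    rw [supp_bI] at hs
    exact (not_subset_of_mem_freeEdges hv hab (hs (Or.inl rfl))).elim
  | b' v w h =>
    rw [supp_bI'] at hs
    have e := pair_eq_pair_of_subset (mem_freeEdges_iff.1 h).1.ne hs
    have : aI' k a b = aI' k v w := by rw [aI', aI', e]
    rw [this]
    exact .single (.b'_a' v w h)
  | c v w h =>
    rw [supp_cI] at hs
    exact (not_subset_of_mem_freeEdges (core_adj_iff.1 h).2.1 hab (hs (by simp))).elim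
  | d v w h =>
    rw [supp_dI] at hs
    exact (not_subset_of_mem_freeEdges (core_adj_iff.1 h).2.1 hab (hs (by simp))).elim
  | e v hv h =>
    rw [supp_eI] at hs
    exact (not_subset_of_mem_freeEdges hv hab (hs rfl)).elim
  | m h => exact .head (.m_b' h a b hab) (.single (.b'_a' a b hab))

theorem pLE_bI (hG : 5 ≤ G.egirth) (huniv : ∀ v, ¬ G.IsUniversal v) (h : PIdeal k G I)
    {u : Fin n} (hu : u ∈ (core G).verts) (hle : bI k G u ≤ I) :
    pLE k G (elt I) (elt (bI k G u)) := by
  have hs := supp_anti hle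
  have hle' := hle
  rw [supp_bI] at hs
  rw [bI_eq_std] at hle'
  cases h with
  | j =>
    rw [supp_jI] at hs
    exact (not_univ_subset_closedNbr huniv u hs).elim
  | a v hv =>
    obtain ⟨a, -, -, ha, -⟩ := mem_core_iff.1 hv
    exact (not_std_true_le_aI ha hle').elim
  | a' v w h => exact (not_std_true_le_cI (mem_freeEdges_iff.1 h).1 hle').elim
  | b v hv =>
    rw [supp_bI] at hs
    rw [eq_of_closedNbr_subset hG hv hs]
    exact .refl
  | b' v w h =>
    rw [supp_bI'] at hs
    exact ((notMem_closedNbr_of_mem_freeEdges hu h).1 (hs (by simp))).elim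
  | c v w h => exact (not_std_true_le_cI (core_adj_iff.1 h).1 hle').elim
  | d v w h =>
    rw [supp_dI] at hs
    have h1 := hs (by simp : v ∈ ({v, w} : Set (Fin n)))
    have h2 := hs (by simp : w ∈ ({v, w} : Set (Fin n)))
    rcases h1 with rfl | h1
    · exact .single (.d_b_left v w h)
    rcases h2 with rfl | h2
    · exact .single (.d_b_right v w h)
    exact (not_triangle_of_girth hG h1 (core_adj_iff.1 h).1 h2).elim
  | e v hv h =>
    rw [supp_eI] at hs
    exact pLE_e_b hv hu h (hs rfl)
  | m h => exact pLE_m_b h hu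

theorem pLE_bI' (huniv : ∀ v, ¬ G.IsUniversal v) (h : PIdeal k G I) {a b : Fin n}
    (hab : s(a, b) ∈ freeEdges G) (hle : bI' k a b ≤ I) :
    pLE k G (elt I) (elt (bI' k a b)) := by
  have hs := supp_anti hle
  have hle' := hle
  rw [supp_bI'] at hs
  rw [bI'_eq_std] at hle'
  cases h with
  | j =>
    rw [supp_jI] at hs
    exact (not_univ_subset_pair huniv (mem_freeEdges_iff.1 hab).1 hs).elim
  | a v hv =>
    rw [supp_aI] at hs
    exact (not_closedNbr_subset_pair hv hs).elim
  | a' v w h => exact (not_std_true_le_cI (mem_freeEdges_iff.1 h).1 hle').elim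
  | b v hv =>
    rw [supp_bI] at hs
    exact (not_closedNbr_subset_pair hv hs).elim
  | b' v w h =>
    rw [supp_bI'] at hs
    have e := pair_eq_pair_of_subset (mem_freeEdges_iff.1 h).1.ne hs
    refine pLE_refl_of_eq ?_
    rw [bI'_eq_std, bI'_eq_std, e]
  | c v w h => exact (not_std_true_le_cI (core_adj_iff.1 h).1 hle').elim
  | d v w h =>
    rw [supp_dI] at hs
    exact (not_subset_of_mem_freeEdges (core_adj_iff.1 h).2.1 hab (hs (by simp))).elim
  | e v hv h =>
    rw [supp_eI] at hs
    exact (not_subset_of_mem_freeEdges hv hab (hs rfl)).elim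
  | m h => exact .single (.m_b' h a b hab)

/-- Inside a core edge the only possible supports are the edge, one endpoint and the empty set. The
support alone does not separate 𝔠 from 𝔡, so 𝔠 is left as a second alternative, which serves both as
upper bounds. -/
theorem pLE_dI_of_supp (huniv : ∀ v, ¬ G.IsUniversal v) (h : PIdeal k G I) {a b : Fin n}
    (hab : (core G).Adj a b) (hs : supp I ⊆ {a, b}) :
    pLE k G (elt I) (elt (dI k a b)) ∨ I = cI k a b := by
  obtain ⟨hadj, ha, hb⟩ := core_adj_iff.1 hab
  have hfree : ∀ {v w}, s(v, w) ∈ freeEdges G → ¬ ({v, w} : Set (Fin n)) ⊆ {a, b} := by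
    intro v w h hs
    have e := pair_eq_pair_of_subset (mem_freeEdges_iff.1 h).1.ne hs
    refine not_subset_of_mem_freeEdges ha h ?_
    rw [e]
    simp
  cases h with
  | j =>
    rw [supp_jI] at hs
    exact (not_univ_subset_pair huniv hadj hs).elim
  | a v hv =>
    rw [supp_aI] at hs
    exact (not_closedNbr_subset_pair hv hs).elim
  | a' v w h =>
    rw [supp_aI'] at hs
    exact (hfree h hs).elim
  | b v hv =>
    rw [supp_bI] at hs
    exact (not_closedNbr_subset_pair hv hs).elim
  | b' v w h =>
    rw [supp_bI'] at hs
    exact (hfree h hs).elim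
  | c v w h =>
    rw [supp_cI] at hs
    right
    rw [cI, cI, pair_eq_pair_of_subset (core_adj_iff.1 h).1.ne hs]
  | d v w h =>
    rw [supp_dI] at hs
    refine Or.inl (pLE_refl_of_eq ?_)
    rw [dI_eq_std, dI_eq_std, pair_eq_pair_of_subset (core_adj_iff.1 h).1.ne hs]
  | e v hv h =>
    rw [supp_eI] at hs
    left
    rcases hs rfl with rfl | rfl
    · exact .single (.e_d _ _ h hab)
    · rw [dI_comm]
      exact .single (.e_d _ _ h hab.symm)
  | m h => exact Or.inl (pLE_m_d h hab)

theorem pLE_eI_of_supp (h : PIdeal k G I) {u : Fin n} (hu : u ∈ (core G).verts)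
    (hu' : 1 < ((core G).neighborSet u).ncard) (hs : supp I ⊆ {u}) :
    pLE k G (elt I) (elt (eI k u)) := by
  have hpair : ∀ {v w}, G.Adj v w → ¬ ({v, w} : Set (Fin n)) ⊆ {u} := by
    intro v w hvw h
    exact hvw.ne ((h (by simp : v ∈ ({v, w} : Set (Fin n)))).trans
      (h (by simp : w ∈ ({v, w} : Set (Fin n)))).symm)
  have hnbr : ∀ {v}, v ∈ (core G).verts → ¬ closedNbr G v ⊆ {u} := by
    intro v hv h
    refine not_closedNbr_subset_pair (a := u) (b := u) hv ?_
    simpa using h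
  cases h with
  | j =>
    rw [supp_jI] at hs
    exact (hnbr hu ((Set.subset_univ _).trans hs)).elim
  | a v hv =>
    rw [supp_aI] at hs
    exact (hnbr hv hs).elim
  | a' v w h =>
    rw [supp_aI'] at hs
    exact (hpair (mem_freeEdges_iff.1 h).1 hs).elim
  | b v hv =>
    rw [supp_bI] at hs
    exact (hnbr hv hs).elim
  | b' v w h =>
    rw [supp_bI'] at hs
    exact (hpair (mem_freeEdges_iff.1 h).1 hs).elim
  | c v w h =>
    rw [supp_cI] at hs
    exact (hpair (core_adj_iff.1 h).1 hs).elim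
  | d v w h =>
    rw [supp_dI] at hs
    exact (hpair (core_adj_iff.1 h).1 hs).elim
  | e v hv h =>
    rw [supp_eI, Set.singleton_subset_singleton] at hs
    rw [hs]
    exact .refl
  | m h => exact .single (.m_e h u hu hu')

theorem eq_mI_of_supp (h : PIdeal k G I) (u : Fin n) (hs : supp I ⊆ ∅) : I = mI k n := by
  cases h with
  -- The vertex `u` guarantees that the support of 𝔧 is nonempty.
  | j =>
    rw [supp_jI] at hs
    exact (hs (Set.mem_univ u)).elim
  | a v hv =>
    rw [supp_aI] at hs
    exact (hs (Or.inl rfl : v ∈ closedNbr G v)).elim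
  | a' v w h =>
    rw [supp_aI'] at hs
    exact (hs (by simp : v ∈ ({v, w} : Set (Fin n)))).elim
  | b v hv =>
    rw [supp_bI] at hs
    exact (hs (Or.inl rfl : v ∈ closedNbr G v)).elim
  | b' v w h =>
    rw [supp_bI'] at hs
    exact (hs (by simp : v ∈ ({v, w} : Set (Fin n)))).elim
  | c v w h =>
    rw [supp_cI] at hs
    exact (hs (by simp : v ∈ ({v, w} : Set (Fin n)))).elim
  | d v w h =>
    rw [supp_dI] at hs
    exact (hs (by simp : v ∈ ({v, w} : Set (Fin n)))).elim
  | e v hv h =>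
    rw [supp_eI] at hs
    exact (hs (Set.mem_singleton v)).elim
  | m h => rfl

theorem pLE_of_le (hG : 5 ≤ G.egirth) (huniv : ∀ v, ¬ G.IsUniversal v) (u : Fin n)
    {I' : Ideal (PolyRing k n)} (h : PIdeal k G I) (h' : PIdeal k G I') (hle : I' ≤ I) :
    pLE k G (elt I) (elt I') := by
  have hs := supp_anti hle
  cases h' with
  | j => exact pLE_jI h hle
  | a v hv => exact pLE_aI hG huniv h hv hle
  | a' v w hvw => exact pLE_aI' hG huniv h hvw hle
  | b v hv => exact pLE_bI hG huniv h hv hle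
  | b' v w hvw => exact pLE_bI' huniv h hvw hle
  | c v w hvw =>
    rw [supp_cI] at hs
    rcases pLE_dI_of_supp huniv h hvw hs with h1 | rfl
    · exact h1.tail (.d_c v w hvw)
    · exact .refl
  | d v w hvw =>
    rw [supp_dI] at hs
    rcases pLE_dI_of_supp huniv h hvw hs with h1 | rfl
    · exact h1
    · rw [dI_eq_std] at hle
      exact (not_std_true_le_cI (core_adj_iff.1 hvw).1 hle).elim
  | e v hv hv' =>
    rw [supp_eI] at hs
    exact pLE_eI_of_supp h hv hv' hs
  | m hm =>
    rw [supp_mI] at hs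
    exact pLE_refl_of_eq (eq_mI_of_supp h u hs)

end Order

end BinomialEdge

end

/-! ### Equality of the two posets -/

theorem mainTheorem6 (k : Type*) [Field k] (n : ℕ) (hn : 4 ≤ n) (G : SimpleGraph (Fin n))
    (hgirth : 5 ≤ G.egirth) (huniv : ∀ v, ¬ G.IsUniversal v) (hedge : G.edgeSet.Nonempty) :
    BinomialEdge.qPoset k Gᶜ = BinomialEdge.pPoset k G ∧
      ∀ p ∈ BinomialEdge.qPoset k Gᶜ, ∀ q ∈ BinomialEdge.qPoset k Gᶜ,
        p ≤ q ↔ BinomialEdge.pLE k G p q := by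
  have hQ : BinomialEdge.qPoset k Gᶜ = BinomialEdge.pPoset k G := by
    rw [BinomialEdge.qPoset, BinomialEdge.pPoset, BinomialEdge.qIdeals_compl_eq hgirth huniv]
  refine ⟨hQ, fun p hp q hq => ⟨fun h => ?_, BinomialEdge.le_of_pLE⟩⟩
  rw [hQ] at hp hq
  rcases hp with rfl | ⟨I, hI, rfl⟩
  · rw [top_le_iff.1 h]
    exact .refl
  rcases hq with rfl | ⟨I', hI', rfl⟩
  · exact BinomialEdge.pLE_top hI
  · exact BinomialEdge.pLE_of_le hgirth huniv ⟨0, by omega⟩ hI hI'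
      (BinomialEdge.elt_le_elt.1 h)
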